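/- Let $E$ be a finite-dimensional simple $\mathbf{Q}$-algebra with center $F$, and assume that $E$ is polarizable: it carries a positive involution $*$, i.e. a $\mathbf{Q}$-linear map $x\mapsto x^*$ with $(x^*)^*=x$, $(xy)^*=y^*x^*$ and $\operatorname{Tr}_E(xx^*)>0$ for all $x\neq 0$, where $\operatorname{Tr}_E(x)$ is the trace of left multiplication by $x$ on the $\mathbf{Q}$-vector space $E$. Fix such a $*$. Write $E\simeq \mathrm{M}_n(D)$ with $D$ a division algebra (whose center is identified with $F$), and put $f=[F:\mathbf{Q}]$. A $\mathbf{C}$-representation of $E$ is a finite-dimensional complex vector space $V$ with a morphism of $\mathbf{Q}$-algebras $\rho\colon E\to\operatorname{End}_{\mathbf{C}}V$. It is rational if for all $x\in E$ the characteristic polynomial of $\rho(x)$ has coefficients in $\mathbf{Q}$. Its dual $V^\vee$ is the dual space on which $x\in E$ acts by the transpose of $\rho(x^*)$; $V$ is polarized if there is a nondegenerate alternating bilinear form on $V$ whose induced map $V\to V^\vee$ is an isomorphism of representations. A multiple of $V$ is a representation isomorphic to $V^m$ for an integer $m\ge 0$. For each embedding $\sigma\colon F\to\mathbf{C}$ let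 $V_\sigma$ be the simple $\mathbf{C}$-representation of $E$ on which $F$ acts through $\sigma$, and let $V_r(E)=\bigoplus_{\sigma}V_\sigma$, the sum over all embeddings $\sigma\colon F\to\mathbf{C}$. The type of $E$ is that of $D$: type I if $D=F$ is a totally real field; type II (resp. III) if $F$ is totally real, $[D:F]=4$ and $\mathbf{R}\otimes_{F,\sigma}D\simeq \mathrm{M}_2(\mathbf{R})$ (resp. $\simeq\mathbf{H}$, the Hamilton quaternions) for every embedding $\sigma\colon F\to\mathbf{R}$; type IV if $F$ is a CM field, i.e. a totally imaginary quadratic extension of a totally real field. Then: 1. $V_r(E)$ is rational, and every rational $\mathbf{C}$-representation of $E$ is a multiple of $V_r(E)$. 2. $[D:F]=d^2$ for some integer $d\ge 0$, and $\dim_{\mathbf{C}}V_r(E)=\deg E$, where $\deg E=ndf$. 3. There is a rational and polarized $\mathbf{C}$-representation $V_{rp}(E)$ of $E$, unique up to isomorphism, such that every rational and polarized $\mathbf{C}$-representation of $E$ is a multiple of $V_{rp}(E)$. 4. $V_{rp}(E)\simeq V_r(E)$ if $E$ is of type III or IV, and $V_{rp}(E)\simeq V_r(E)^2$ if $E$ is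 of type I or II. -/

import Mathlib

universe u v w

open scoped TensorProduct Quaternion

noncomputable section

namespace RatRep

/-! ### Representations of a `ℚ`-algebra on complex vector spaces

A `ℂ`-representation of `E` is a complex vector space `V` with a ring homomorphism
`ρ : E →+* Module.End ℂ V`; for a `ℚ`-algebra `E` such a homomorphism is automatically
`ℚ`-linear. -/

section Representations

variable {E : Type u} [Ring E]

/-- Two representations are isomorphic: there is an equivariant linear isomorphism. -/
def Iso {V : Type v} [AddCommGroup V] [Module ℂ V] (ρ : E →+* Module.End ℂ V)
    {W : Type w} [AddCommGroup W] [Module ℂ W] (ρ' : E →+* Module.End ℂ W) : Prop :=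
  ∃ e : V ≃ₗ[ℂ] W, ∀ (x : E) (y : V), e (ρ x y) = ρ' x (e y)

/-- The componentwise action on a product of representations (for a finite index set: their
direct sum). -/
def directSum {ι : Type w} {V : ι → Type v} [∀ i, AddCommGroup (V i)] [∀ i, Module ℂ (V i)]
    (ρ : ∀ i, E →+* Module.End ℂ (V i)) : E →+* Module.End ℂ (∀ i, V i) where
  toFun x := LinearMap.pi fun i => (ρ i x) ∘ₗ LinearMap.proj i
  map_one' := by ext; simp
  map_mul' x y := by
    refine LinearMap.ext fun y => funext fun i => ?_
    simp
  map_zero' := by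
    refine LinearMap.ext fun y => funext fun i => ?_
    simp
  map_add' x y := by
    refine LinearMap.ext fun y => funext fun i => ?_
    simp

/-- The multiple `V ^ m` of a representation. -/
def multiple {V : Type v} [AddCommGroup V] [Module ℂ V] (m : ℕ) (ρ : E →+* Module.End ℂ V) :
    E →+* Module.End ℂ (Fin m → V) :=
  directSum fun _ : Fin m => ρ

/-- A nonzero representation without invariant subspaces other than `0` and `V`. -/
def IsSimple {V : Type v} [AddCommGroup V] [Module ℂ V] (ρ : E →+* Module.End ℂ V) : Prop :=
  Nontrivial V ∧ ∀ p : Submodule ℂ V, (∀ (x : E), ∀ y ∈ p, ρ x y ∈ p) → p = ⊥ ∨ p = ⊤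

/-- A finite-dimensional representation is rational if the characteristic polynomial of every
element of `E` has rational coefficients. -/
def IsRational {V : Type v} [AddCommGroup V] [Module ℂ V] [FiniteDimensional ℂ V]
    (ρ : E →+* Module.End ℂ V) : Prop :=
  ∀ x : E, ∃ p : Polynomial ℚ, (ρ x).charpoly = p.map (algebraMap ℚ ℂ)

end Representations

/-! ### Positive involutions, dual representations, polarized representations -/

/-- A positive involution on a `ℚ`-algebra `E`: a `ℚ`-linear involutive
anti-automorphism such that left multiplication by `x x *` on the `ℚ`-vector space `E` has
positive trace for every `x ≠ 0`. -/
structure PositiveInvolution (E : Type u) [Ring E] [Algebra ℚ E] where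
  toLin : E →ₗ[ℚ] E
  invol : ∀ x, toLin (toLin x) = x
  anti : ∀ x y, toLin (x * y) = toLin y * toLin x
  pos : ∀ x, x ≠ 0 → 0 < LinearMap.trace ℚ E (LinearMap.mulLeft ℚ (x * toLin x))

namespace PositiveInvolution

theorem map_one {E : Type u} [Ring E] [Algebra ℚ E] (τ : PositiveInvolution E) :
    τ.toLin 1 = 1 := by
  have h := τ.anti (τ.toLin 1) 1
  rw [mul_one, τ.invol, mul_one] at h
  exact h.symm

end PositiveInvolution

section Polarized

variable {E : Type u} [Ring E] [Algebra ℚ E]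

/-- The dual representation: `x` acts on the dual space by the transpose of `ρ (x *)`. -/
def dualRep (τ : PositiveInvolution E) {V : Type v} [AddCommGroup V] [Module ℂ V]
    (ρ : E →+* Module.End ℂ V) : E →+* Module.End ℂ (Module.Dual ℂ V) where
  toFun x := (ρ (τ.toLin x)).dualMap
  map_one' := by ext; simp [τ.map_one]
  map_mul' x y := by ext; simp [τ.anti]
  map_zero' := by ext; simp
  map_add' x y := by ext; simp

/-- A representation is polarized if there is a nondegenerate alternating bilinear form on it
such that the induced map `V → V^∨` is a map of representations. -/
def IsPolarized (τ : PositiveInvolution E) {V : Type v} [AddCommGroup V] [Module ℂ V]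
    (ρ : E →+* Module.End ℂ V) : Prop :=
  ∃ B : LinearMap.BilinForm ℂ V, B.IsAlt ∧ B.Nondegenerate ∧
    ∀ (x : E) (y : V), B (ρ x y) = dualRep τ ρ x (B y)

end Polarized

/-! ### The representation `V_r(E)` -/

section Vr

variable (E : Type u) [Ring E] [Algebra ℚ E]

/-- The center of `E`, as a `ℚ`-algebra. -/
abbrev Center : Type u := Subalgebra.center ℚ E

instance : Algebra (Center E) E :=
  inferInstanceAs (Algebra (Subring.center E) E)

instance : IsScalarTower ℚ (Center E) E :=
  ⟨fun a z x => smul_mul_assoc a (z : E) x⟩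

variable {E}

/-- The field `ℂ`, regarded as an extension of the center `F` of `E` through the embedding `σ`. -/
def CAlong (_σ : Center E →ₐ[ℚ] ℂ) : Type := ℂ

instance (σ : Center E →ₐ[ℚ] ℂ) : Field (CAlong σ) := inferInstanceAs (Field ℂ)

instance (σ : Center E →ₐ[ℚ] ℂ) : Algebra ℂ (CAlong σ) := inferInstanceAs (Algebra ℂ ℂ)

instance (σ : Center E →ₐ[ℚ] ℂ) : Algebra (Center E) (CAlong σ) :=
  ((algebraMap ℂ (CAlong σ)).comp σ.toRingHom).toAlgebra

/-- The complex algebra `ℂ ⊗_F E`, for an embedding `σ` of the center `F` of `E`. -/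
def ScalarExt (σ : Center E →ₐ[ℚ] ℂ) : Type u := CAlong σ ⊗[Center E] E

instance (σ : Center E →ₐ[ℚ] ℂ) : Ring (ScalarExt σ) :=
  inferInstanceAs (Ring (CAlong σ ⊗[Center E] E))

instance (σ : Center E →ₐ[ℚ] ℂ) : Algebra ℂ (ScalarExt σ) :=
  inferInstanceAs (Algebra ℂ (CAlong σ ⊗[Center E] E))

instance (σ : Center E →ₐ[ℚ] ℂ) : FiniteDimensional ℂ (CAlong σ) :=
  inferInstanceAs (FiniteDimensional ℂ ℂ)

/-- The map `x ↦ 1 ⊗ x` from `E` to `ℂ ⊗_F E`. -/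
def ScalarExt.incl (σ : Center E →ₐ[ℚ] ℂ) : E →+* ScalarExt σ :=
  (Algebra.TensorProduct.includeRight : E →ₐ[Center E] CAlong σ ⊗[Center E] E).toRingHom

theorem ScalarExt.incl_center (σ : Center E →ₐ[ℚ] ℂ) (z : Center E) :
    ScalarExt.incl σ z = algebraMap ℂ (ScalarExt σ) (σ z) := by
  change (1 : CAlong σ) ⊗ₜ[Center E] (z : E) =
    (algebraMap ℂ (CAlong σ) (σ z)) ⊗ₜ[Center E] (1 : E)
  have h1 : (z : E) = z • (1 : E) := by
    rw [Algebra.smul_def, mul_one]; rfl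
  have h2 : algebraMap ℂ (CAlong σ) (σ z) = z • (1 : CAlong σ) := by
    rw [Algebra.smul_def, mul_one]; rfl
  rw [h1, h2, TensorProduct.smul_tmul]

theorem ScalarExt.span_incl (σ : Center E →ₐ[ℚ] ℂ) :
    Submodule.span ℂ (Set.range (ScalarExt.incl σ)) = ⊤ := by
  refine eq_top_iff.2 fun t _ => ?_
  change CAlong σ ⊗[Center E] E at t
  induction t using TensorProduct.induction_on with
  | zero => exact Submodule.zero_mem _
  | tmul c x =>
    have h : (c ⊗ₜ[Center E] x : CAlong σ ⊗[Center E] E) =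
        (show ℂ from c) • ((1 : CAlong σ) ⊗ₜ[Center E] x) := by
      rw [TensorProduct.smul_tmul', Algebra.smul_def, mul_one]
      rfl
    exact h ▸ Submodule.smul_mem _ _ (Submodule.subset_span ⟨x, rfl⟩)
  | add a b ha hb => exact Submodule.add_mem _ (ha trivial) (hb trivial)

instance [FiniteDimensional ℚ E] : Module.Finite (Center E) E :=
  Module.Finite.of_restrictScalars_finite ℚ _ _

instance [FiniteDimensional ℚ E] (σ : Center E →ₐ[ℚ] ℂ) :
    FiniteDimensional ℂ (ScalarExt σ) :=
  have : Module.Finite ℂ (CAlong σ ⊗[Center E] E) :=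
    Module.Finite.trans (CAlong σ) (CAlong σ ⊗[Center E] E)
  this

variable (E) in
theorem isField_center [IsSimpleRing E] : IsField (Center E) :=
  IsSimpleRing.isField_center E

instance [IsSimpleRing E] (σ : Center E →ₐ[ℚ] ℂ) : Nontrivial (ScalarExt σ) :=
  let : Field (Center E) := (isField_center E).toField
  have h1 : Module.Flat (Center E) E := inferInstance
  have h2 : Function.Injective (algebraMap (Center E) (CAlong σ)) := by
    refine (injective_iff_map_eq_zero _).2 fun z hz => ?_
    by_contra hne
    obtain ⟨y, hy⟩ := (isField_center E).mul_inv_cancel hne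
    have := congrArg (algebraMap (Center E) (CAlong σ)) hy
    rw [map_mul, hz, zero_mul, map_one] at this
    exact zero_ne_one this
  have : Nontrivial E := inferInstance
  Algebra.TensorProduct.nontrivial_of_algebraMap_injective_of_flat_right
    (Center E) (CAlong σ) E h2

/-- A maximal left ideal of `ℂ ⊗_F E`. -/
def maxLeftIdeal [IsSimpleRing E] (σ : Center E →ₐ[ℚ] ℂ) : Ideal (ScalarExt σ) :=
  (Ideal.exists_maximal (ScalarExt σ)).choose

theorem maxLeftIdeal_isMaximal [IsSimpleRing E] (σ : Center E →ₐ[ℚ] ℂ) :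
    (maxLeftIdeal σ).IsMaximal :=
  (Ideal.exists_maximal (ScalarExt σ)).choose_spec

/-- The space of the simple representation of `E` on which the center acts through `σ`: a simple
module over `ℂ ⊗_F E`. -/
def SimpleSpace [IsSimpleRing E] (σ : Center E →ₐ[ℚ] ℂ) : Type u :=
  ScalarExt σ ⧸ maxLeftIdeal σ

instance [IsSimpleRing E] (σ : Center E →ₐ[ℚ] ℂ) : AddCommGroup (SimpleSpace σ) :=
  inferInstanceAs (AddCommGroup (ScalarExt σ ⧸ maxLeftIdeal σ))

instance [IsSimpleRing E] (σ : Center E →ₐ[ℚ] ℂ) : Module (ScalarExt σ) (SimpleSpace σ) :=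
  inferInstanceAs (Module (ScalarExt σ) (ScalarExt σ ⧸ maxLeftIdeal σ))

instance [IsSimpleRing E] (σ : Center E →ₐ[ℚ] ℂ) : Module ℂ (SimpleSpace σ) :=
  Module.compHom (SimpleSpace σ) (algebraMap ℂ (ScalarExt σ))

instance [IsSimpleRing E] (σ : Center E →ₐ[ℚ] ℂ) :
    IsScalarTower ℂ (ScalarExt σ) (SimpleSpace σ) :=
  IsScalarTower.of_algebraMap_smul fun _ _ => rfl

instance [IsSimpleRing E] (σ : Center E →ₐ[ℚ] ℂ) :
    SMulCommClass (ScalarExt σ) ℂ (SimpleSpace σ) :=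
  IsScalarTower.to_smulCommClass'

/-- The simple representation of `E` on which the center acts through `σ`. -/
def simpleRep [IsSimpleRing E] (σ : Center E →ₐ[ℚ] ℂ) :
    E →+* Module.End ℂ (SimpleSpace σ) :=
  (Module.toModuleEnd ℂ (S := ScalarExt σ) (SimpleSpace σ)).comp (ScalarExt.incl σ)

/-- The representation `V_σ` is simple. -/
theorem isSimple_simpleRep [IsSimpleRing E] (σ : Center E →ₐ[ℚ] ℂ) :
    IsSimple (simpleRep σ) := by
  have : IsSimpleModule (ScalarExt σ) (SimpleSpace σ) :=
    isSimpleModule_iff_isCoatom.2 (maxLeftIdeal_isMaximal σ).out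
  refine ⟨IsSimpleModule.nontrivial (ScalarExt σ) _, fun p hp => ?_⟩
  have key : ∀ (t : ScalarExt σ), ∀ y ∈ p, t • y ∈ p := by
    intro t y hy
    have ht : t ∈ Submodule.span ℂ (Set.range (ScalarExt.incl σ)) := by
      rw [ScalarExt.span_incl]; trivial
    induction ht using Submodule.span_induction with
    | mem x hx =>
      obtain ⟨x, rfl⟩ := hx
      exact hp x y hy
    | zero =>
      have h0 : (0 : ScalarExt σ) • y = 0 := zero_smul _ y
      exact h0 ▸ p.zero_mem
    | add a b _ _ ha hb => rw [add_smul]; exact p.add_mem ha hb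
    | smul c a _ ha => rw [smul_assoc]; exact p.smul_mem c ha
  let q : Submodule (ScalarExt σ) (SimpleSpace σ) :=
    { carrier := p
      add_mem' := p.add_mem
      zero_mem' := p.zero_mem
      smul_mem' := fun t y hy => key t y hy }
  rcases eq_bot_or_eq_top q with h | h
  · left
    refine (Submodule.eq_bot_iff _).2 fun y hy => ?_
    have : y ∈ q := hy
    rw [h] at this
    exact this
  · right
    refine eq_top_iff.2 fun y _ => ?_
    have : y ∈ q := by rw [h]; trivial
    exact this

/-- The center acts on `V_σ` through `σ`. -/
theorem simpleRep_center [IsSimpleRing E] (σ : Center E →ₐ[ℚ] ℂ) (z : Center E)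
    (y : SimpleSpace σ) : simpleRep σ z y = σ z • y := by
  change ScalarExt.incl σ z • y = _
  rw [ScalarExt.incl_center, algebraMap_smul]

instance [IsSimpleRing E] [FiniteDimensional ℚ E] (σ : Center E →ₐ[ℚ] ℂ) :
    FiniteDimensional ℂ (SimpleSpace σ) :=
  have : Module.Finite (ScalarExt σ) (SimpleSpace σ) :=
    inferInstanceAs (Module.Finite (ScalarExt σ) (ScalarExt σ ⧸ maxLeftIdeal σ))
  Module.Finite.trans (ScalarExt σ) (SimpleSpace σ)

/-- The central trace of `V_σ` is a multiple of `σ`. -/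
theorem trace_simpleRep [IsSimpleRing E] [FiniteDimensional ℚ E] (σ : Center E →ₐ[ℚ] ℂ)
    (z : Center E) :
    LinearMap.trace ℂ _ (simpleRep σ z) = Module.finrank ℂ (SimpleSpace σ) * σ z := by
  have h : simpleRep σ z = σ z • LinearMap.id :=
    LinearMap.ext fun y => simpleRep_center σ z y
  rw [h, map_smul, LinearMap.trace_id, smul_eq_mul, mul_comm]

instance [IsSimpleRing E] [FiniteDimensional ℚ E] : Finite (Center E →ₐ[ℚ] ℂ) := by
  let : Field (Center E) := (isField_center E).toField
  infer_instance

variable (E)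

/-- The space of `V_r(E)`, the (finite) direct sum of the `V_σ` over all embeddings `σ` of the
center of `E` in `ℂ`. -/
abbrev VrSpace [IsSimpleRing E] : Type u := ∀ σ : Center E →ₐ[ℚ] ℂ, SimpleSpace σ

/-- The representation `V_r(E)`. -/
def Vr [IsSimpleRing E] : E →+* Module.End ℂ (VrSpace E) :=
  directSum fun σ : Center E →ₐ[ℚ] ℂ => simpleRep σ

end Vr

/-! ### The representation `V_rp(E)` -/

/-- `ρ` is rational and polarized, and every rational polarized representation (in the same
universe) is isomorphic to a multiple of `ρ`. -/
def GeneratesRationalPolarized {E : Type u} [Ring E] [Algebra ℚ E] (τ : PositiveInvolution E)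
    {W : Type v} [AddCommGroup W] [Module ℂ W] [FiniteDimensional ℂ W]
    (ρ : E →+* Module.End ℂ W) : Prop :=
  IsRational ρ ∧ IsPolarized τ ρ ∧
    ∀ (V : Type v) [AddCommGroup V] [Module ℂ V] [FiniteDimensional ℂ V]
      (θ : E →+* Module.End ℂ V), IsRational θ → IsPolarized τ θ → ∃ m : ℕ, Iso θ (multiple m ρ)

/-! ### Albert types of a division algebra, with center `F = Subring.center D` -/

section Types

variable (D : Type w) [DivisionRing D]

/-- The completion `ℝ ⊗_F D` of `D` at a real embedding `σ` of its center is isomorphic to the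
real algebra `A`. -/
def RealCompletionIso (σ : Subring.center D →+* ℝ) (A : Type) [Ring A] [Algebra ℝ A] : Prop :=
  letI : Algebra (Subring.center D) ℝ := σ.toAlgebra
  Nonempty ((ℝ ⊗[Subring.center D] D) ≃ₐ[ℝ] A)

/-- Type I: `D` is a totally real field. -/
def IsTypeI : Prop :=
  (∀ x y : D, x * y = y * x) ∧ NumberField.IsTotallyReal (Subring.center D)

/-- Type II: `D` is a quaternion algebra over its totally real center, split at all real
places. -/
def IsTypeII : Prop :=
  Module.finrank (Subring.center D) D = 4 ∧ NumberField.IsTotallyReal (Subring.center D) ∧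
    ∀ σ : Subring.center D →+* ℝ, RealCompletionIso D σ (Matrix (Fin 2) (Fin 2) ℝ)

/-- Type III: `D` is a quaternion algebra over its totally real center, definite at all real
places. -/
def IsTypeIII : Prop :=
  Module.finrank (Subring.center D) D = 4 ∧ NumberField.IsTotallyReal (Subring.center D) ∧
    ∀ σ : Subring.center D →+* ℝ, RealCompletionIso D σ ℍ[ℝ]

/-- Type IV: the center of `D` is a CM field. For an algebra that carries a positive involution
the conditions on the local invariants of `D` in the usual description of type IV are automatic
(they express that `D` has an involution inducing complex conjugation on its center), so they are
not repeated here. -/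
def IsTypeIV [CharZero (Subring.center D)] : Prop :=
  NumberField.IsCMField (Subring.center D)

instance [Algebra ℚ D] : CharZero (Subring.center D) :=
  haveI : CharZero D := algebraRat.charZero D
  (Subring.center D).subtype.charZero_iff (Subtype.val_injective) |>.2 inferInstance

end Types

end RatRep

end

open scoped TensorProduct Quaternion ComplexConjugate

noncomputable section

/-! ### Roots of rational polynomials -/

/-! Base change of `E` along an embedding `σ` of its center `F` gives a central simple complex
algebra `ℂ ⊗_F E`. Its unique simple module is `V_σ`, and Burnside's theorem gives `(dim V_σ)² = [E
: F]`, hence the dimension formula. Idempotents coming from `F` split any representation into its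
`σ`-parts, so it is `⨁ V_σ ^ m_σ`. If the trace is rational on `F`, nondegeneracy of the trace form
and independence of the embeddings force `m_σ` to be constant, and the representation is a multiple
of `V_r`. The complexified regular representation is thus `V_r ^ k` with `k ≠ 0`. A monic polynomial
with a positive power over `ℚ` is itself over `ℚ`, so `V_r` is rational.

The dual of `V_r` is rational of the same dimension, so `V_r` is self-dual, and the hyperbolic form
polarizes `V_r ^ 2`. An invariant form on `V_r` pairs `V_σ` with `V_σ̄`, where `σ̄ = σ ∘ *`. If `σ̄
≠ σ`, the pairing can be made alternating at will. If `σ̄ = σ`, Schur's lemma makes the form on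
`V_σ` unique up to scalar, with a definite sign. If every such sign is `-1`, then `V_r` is
polarized. If one of them is `+1`, a polarization of `V_r ^ m` yields an invertible skew matrix of
size `m`, so `m` is even. Hence the generator `V_rp` is `V_r` or `V_r ^ 2` (`isPolarized_vr`,
`hasForm_neg_one_of_isPolarized`).

The types decide the signs through positivity. If `F` is totally real, then `*` is trivial on `F`,
and the real structure of the completions gives an equivariant antilinear `J` on `V_σ` with `J² =
δ`, where `δ = 1` in types I and II and `δ = -1` in type III. By `not_hasForm_neg` the sign of the
form is then `δ`. If `F` is CM, positivity excludes `σ̄ = σ`, and there is no obstruction. -/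

/-- If some positive power of a monic polynomial `p` over an extension is defined over a perfect
field, so is `p`. -/
theorem Polynomial.Monic.exists_map_of_pow {k K : Type*} [Field k] [Field K] [PerfectField k]
    [Algebra k K] {r : ℕ} (hr : r ≠ 0) {p : Polynomial K} (hp : p.Monic) {q : Polynomial k}
    (h : p ^ r = q.map (algebraMap k K)) : ∃ p₀ : Polynomial k, p = p₀.map (algebraMap k K) := by
  induction hn : p.natDegree using Nat.strong_induction_on generalizing p q with
  | _ n ih =>
  by_cases hn0 : n = 0
  · exact ⟨1, by rw [Polynomial.map_one]; exact hp.natDegree_eq_zero.1 (hn.trans hn0)⟩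
  have hq : q.Monic := by
    have := hp.pow r
    rw [h] at this
    exact (Polynomial.monic_map_iff).1 this
  have hdeg : r * n = q.natDegree := by
    rw [← hn, ← hp.natDegree_pow, h, Polynomial.natDegree_map]
  have hqu : ¬ IsUnit q := fun hu => by
    have := Polynomial.natDegree_eq_zero_of_isUnit hu
    rw [← hdeg] at this
    exact (mul_ne_zero hr hn0) this
  obtain ⟨g, hg, hgi, hgq⟩ := Polynomial.exists_monic_irreducible_factor q hqu
  -- Over a perfect field the irreducible factor `g` stays squarefree after extension. It therefore
  -- divides `p` as soon as it divides `p ^ r`, and dividing `q` by `g ^ r` lowers the degree of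
  -- `p`.
  have hsq : Squarefree (g.map (algebraMap k K)) :=
    ((PerfectField.separable_of_irreducible hgi).map).squarefree
  have hgp : g.map (algebraMap k K) ∣ p :=
    (hsq.dvd_pow_iff_dvd hr).1 (h ▸ Polynomial.map_dvd _ hgq)
  obtain ⟨p₁, rfl⟩ := hgp
  have hgm := hg.map (algebraMap k K)
  have hp₁ : p₁.Monic := hgm.of_mul_monic_left hp
  have hgq' : g ^ r ∣ q := by
    rw [← Polynomial.map_dvd_map' (algebraMap k K), ← h, Polynomial.map_pow]
    exact pow_dvd_pow_of_dvd (dvd_mul_right _ _) r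
  obtain ⟨q₁, rfl⟩ := hgq'
  have h1 : p₁ ^ r = q₁.map (algebraMap k K) := by
    rw [mul_pow, Polynomial.map_mul, Polynomial.map_pow] at h
    exact mul_left_cancel₀ (pow_ne_zero _ hgm.ne_zero) h
  have hlt : p₁.natDegree < n := by
    rw [← hn, hgm.natDegree_mul hp₁, Polynomial.natDegree_map]
    have := hgi.natDegree_pos
    omega
  obtain ⟨p₀, rfl⟩ := ih _ hlt hp₁ h1 rfl
  exact ⟨g * p₀, by rw [Polynomial.map_mul]⟩

/-! ### Base change of central simple algebras -/

section CentralSimple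

variable {K A : Type*} [Field K] [Ring A] [Algebra K A] [FiniteDimensional K A] [IsSimpleRing A]
  [Algebra.IsCentral K A]

/-- The left and right multiplications of a central simple algebra generate all its
endomorphisms. -/
theorem Subring.eq_top_of_mulLeft_mem_of_mulRight_mem (S : Subring (Module.End K A))
    (hl : ∀ a, LinearMap.mulLeft K a ∈ S) (hr : ∀ a, LinearMap.mulRight K a ∈ S) : S = ⊤ := by
  -- Submodules over `S` are stable under left and right multiplication, so they are two-sided
  -- ideals.
  have hsimple : IsSimpleModule S A := by
    refine isSimpleModule_iff_toSpanSingleton_surjective.2 ⟨inferInstance, fun x hx y => ?_⟩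
    let I : TwoSidedIdeal A := TwoSidedIdeal.mk' (Submodule.span S {x} : Submodule S A)
      (Submodule.zero_mem _) (fun h1 h2 => Submodule.add_mem _ h1 h2)
      (fun h => Submodule.neg_mem _ h)
      (fun {a b} h => Submodule.smul_mem _ (⟨_, hl a⟩ : S) h)
      (fun {a b} h => Submodule.smul_mem _ (⟨_, hr b⟩ : S) h)
    have hxI : x ∈ I := (TwoSidedIdeal.mem_mk' _ _ _ _ _ _ _).2 (Submodule.mem_span_singleton_self x)
    have h1 : (1 : A) ∈ I := IsSimpleRing.one_mem_of_ne_zero_mem I hx hxI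
    have hy : y ∈ I := by simpa using I.mul_mem_left y 1 h1
    have := (TwoSidedIdeal.mem_mk' _ _ _ _ _ _ _).1 hy
    exact Submodule.mem_span_singleton.1 this
  refine eq_top_iff.2 fun φ _ => ?_
  -- An endomorphism commuting with all multiplications is multiplication by its value at `1`, which
  -- is central. The commutant is therefore `K`, and density applied to a finite basis puts every
  -- `φ` in `S`.
  have hcentral : ∀ f : Module.End S A, ∃ c : K, ∀ x, f x = c • x := by
    intro f
    have h1 : ∀ a x, f (a * x) = a * f x := fun a x => f.map_smul (⟨_, hl a⟩ : S) x
    have h2 : ∀ a x, f (x * a) = f x * a := fun a x => f.map_smul (⟨_, hr a⟩ : S) x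
    have h3 : f 1 ∈ Subalgebra.center K A := by
      refine Subalgebra.mem_center_iff.2 fun b => ?_
      rw [← h1, ← h2, mul_one, one_mul]
    obtain ⟨c, hc⟩ := Algebra.mem_bot.1 (Algebra.IsCentral.out h3)
    refine ⟨c, fun x => ?_⟩
    rw [← mul_one x, h1, ← hc, Algebra.smul_def, Algebra.commutes, mul_one]
  let F : Module.End (Module.End S A) A :=
    { toFun := φ
      map_add' := φ.map_add
      map_smul' := fun f x => by
        obtain ⟨c, hc⟩ := hcentral f
        simp only [Module.End.smul_def, hc, map_smul, RingHom.id_apply] }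
  let b := Module.finBasis K A
  classical
  obtain ⟨r, hr⟩ := jacobson_density (R := S) F (Finset.univ.image b)
  have : φ = r := b.ext fun i => hr (b i) (by simp)
  rw [this]
  exact r.2

/-- The base change of a central simple algebra to an extension field is simple. -/
theorem isSimpleRing_tensorProduct (L : Type*) [Field L] [Algebra K L] :
    IsSimpleRing (L ⊗[K] A) := by
  refine isSimpleRing_iff_isTwoSided_imp.2 ⟨inferInstance, fun I hI => ?_⟩
  refine or_iff_not_imp_left.2 fun hne => ?_
  obtain ⟨y, hy, hy0⟩ := Submodule.exists_mem_ne_zero_of_ne_bot hne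
  -- The maps of `A` whose base change preserves `I` include all multiplications, hence are all of
  -- `End A`. A rank-one map then sends `y` to a nonzero scalar, which lies in `I`.
  let S : Subring (Module.End K A) :=
    { carrier := {φ | ∀ y ∈ I, φ.baseChange L y ∈ I}
      one_mem' := fun y hy => by simpa using hy
      mul_mem' := fun {f g} hf hg y hy => by
        rw [LinearMap.baseChange_mul]; exact hf _ (hg _ hy)
      zero_mem' := fun y hy => by simp
      add_mem' := fun {f g} hf hg y hy => by
        rw [LinearMap.baseChange_add]; exact I.add_mem (hf _ hy) (hg _ hy)
      neg_mem' := fun {f} hf y hy => by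
        rw [LinearMap.baseChange_neg]; exact I.neg_mem (hf _ hy) }
  have hS : S = ⊤ := by
    refine S.eq_top_of_mulLeft_mem_of_mulRight_mem (fun a y hy => ?_) (fun a y hy => ?_)
    · have : (LinearMap.mulLeft K a).baseChange L = LinearMap.mulLeft L ((1 : L) ⊗ₜ[K] a) := by
        ext; simp
      rw [this]
      exact I.mul_mem_left _ hy
    · have : (LinearMap.mulRight K a).baseChange L = LinearMap.mulRight L ((1 : L) ⊗ₜ[K] a) := by
        ext; simp
      rw [this]
      exact I.mul_mem_right _ hy
  let b := Module.finBasis K A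
  let bL := b.baseChange L
  obtain ⟨j, hj⟩ : ∃ j, bL.repr y j ≠ 0 := by
    by_contra! h
    exact hy0 ((bL.repr.map_eq_zero_iff).1 (Finsupp.ext h))
  let φ : Module.End K A := (b.coord j).smulRight 1
  have hφ : φ ∈ S := by rw [hS]; trivial
  have h1 : φ.baseChange L y = bL.repr y j • 1 := by
    have : φ.baseChange L = (bL.coord j).smulRight (1 : L ⊗[K] A) := by
      refine bL.ext fun i => ?_
      simp only [bL, Module.Basis.baseChange_apply, LinearMap.baseChange_tmul, φ,
        LinearMap.smulRight_apply, Module.Basis.coord_apply, Module.Basis.repr_self]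
      rw [← Module.Basis.baseChange_apply, Module.Basis.repr_self]
      by_cases hij : i = j
      · subst hij; simp [Algebra.TensorProduct.one_def]
      · simp [Finsupp.single_eq_of_ne (Ne.symm hij)]
    rw [this]; rfl
  have h2 : bL.repr y j • (1 : L ⊗[K] A) ∈ I := h1 ▸ hφ y hy
  have h3 := I.mul_mem_left ((bL.repr y j)⁻¹ • (1 : L ⊗[K] A)) h2
  rw [smul_mul_smul_comm, inv_mul_cancel₀ hj, one_smul, mul_one] at h3
  exact (Ideal.eq_top_iff_one I).2 h3

end CentralSimple

namespace RatRep

/-! ### Isomorphisms and multiples of representations -/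

section Basic

variable {E : Type*} [Ring E]
variable {V : Type*} [AddCommGroup V] [Module ℂ V] {W : Type*} [AddCommGroup W] [Module ℂ W]
  {U : Type*} [AddCommGroup U] [Module ℂ U]
variable {ρ : E →+* Module.End ℂ V} {θ : E →+* Module.End ℂ W} {η : E →+* Module.End ℂ U}

theorem Iso.symm : Iso ρ θ → Iso θ ρ := fun ⟨e, he⟩ =>
  ⟨e.symm, fun x y => by rw [LinearEquiv.symm_apply_eq, he, e.apply_symm_apply]⟩

theorem Iso.trans : Iso ρ θ → Iso θ η → Iso ρ η := fun ⟨e, he⟩ ⟨e', he'⟩ =>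
  ⟨e.trans e', fun x y => by simp [he, he']⟩

theorem Iso.finrank_eq : Iso ρ θ → Module.finrank ℂ V = Module.finrank ℂ W :=
  fun ⟨e, _⟩ => e.finrank_eq

theorem Iso.exists_conj : Iso ρ θ → ∃ e : V ≃ₗ[ℂ] W, ∀ x, e.conj (ρ x) = θ x :=
  fun ⟨e, he⟩ => ⟨e, fun x => LinearMap.ext fun y => by simp [LinearEquiv.conj_apply, he]⟩

theorem Iso.trace_eq (h : Iso ρ θ) (x : E) :
    LinearMap.trace ℂ V (ρ x) = LinearMap.trace ℂ W (θ x) := by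
  obtain ⟨e, he⟩ := h.exists_conj
  rw [← he, LinearMap.trace_conj']

theorem Iso.charpoly_eq [FiniteDimensional ℂ V] [FiniteDimensional ℂ W] (h : Iso ρ θ) (x : E) :
    (ρ x).charpoly = (θ x).charpoly := by
  obtain ⟨e, he⟩ := h.exists_conj
  rw [← he, LinearEquiv.charpoly_conj]

theorem Iso.isRational [FiniteDimensional ℂ V] [FiniteDimensional ℂ W] (h : Iso ρ θ)
    (hρ : IsRational ρ) : IsRational θ := fun x => h.charpoly_eq x ▸ hρ x

theorem directSum_apply {ι : Type*} {V : ι → Type*} [∀ i, AddCommGroup (V i)]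
    [∀ i, Module ℂ (V i)] (ρ : ∀ i, E →+* Module.End ℂ (V i)) (x : E) (y : ∀ i, V i) (i : ι) :
    directSum ρ x y i = ρ i x (y i) := rfl

theorem multiple_apply (m : ℕ) (ρ : E →+* Module.End ℂ V) (x : E) (y : Fin m → V) (i : Fin m) :
    multiple m ρ x y i = ρ x (y i) := rfl

theorem directSum_single {ι : Type*} [DecidableEq ι] {V : ι → Type*} [∀ i, AddCommGroup (V i)]
    [∀ i, Module ℂ (V i)] (ρ : ∀ i, E →+* Module.End ℂ (V i)) (x : E) (i : ι) (y : V i) :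
    directSum ρ x (Pi.single i y) = Pi.single i (ρ i x y) := by
  funext j
  rw [directSum_apply]
  by_cases h : j = i
  · subst h; simp
  · simp [h]

theorem multiple_single (m : ℕ) (ρ : E →+* Module.End ℂ V) (x : E) (i : Fin m) (y : V) :
    multiple m ρ x (Pi.single i y) = Pi.single i (ρ x y) :=
  directSum_single (fun _ => ρ) x i y

theorem Iso.directSum {ι : Type*} {V W : ι → Type*} [∀ i, AddCommGroup (V i)]
    [∀ i, Module ℂ (V i)] [∀ i, AddCommGroup (W i)] [∀ i, Module ℂ (W i)]
    {ρ : ∀ i, E →+* Module.End ℂ (V i)} {θ : ∀ i, E →+* Module.End ℂ (W i)}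
    (h : ∀ i, Iso (ρ i) (θ i)) : Iso (directSum ρ) (RatRep.directSum θ) := by
  choose e he using h
  exact ⟨LinearEquiv.piCongrRight e, fun x y => funext fun i => he i x (y i)⟩

theorem Iso.multiple (h : Iso ρ θ) (m : ℕ) : Iso (multiple m ρ) (RatRep.multiple m θ) :=
  Iso.directSum fun _ => h

theorem iso_multiple_one (ρ : E →+* Module.End ℂ V) : Iso ρ (multiple 1 ρ) :=
  ⟨(LinearEquiv.funUnique (Fin 1) ℂ V).symm, fun _ _ => rfl⟩

theorem iso_multiple_multiple (ρ : E →+* Module.End ℂ V) (m k : ℕ) :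
    Iso (multiple (m * k) ρ) (multiple m (multiple k ρ)) :=
  ⟨(LinearEquiv.funCongrLeft ℂ V finProdFinEquiv).trans (LinearEquiv.curry ℂ V (Fin m) (Fin k)),
    fun _ _ => rfl⟩

theorem iso_directSum_multiple {ι : Type*} {V : ι → Type*} [∀ i, AddCommGroup (V i)]
    [∀ i, Module ℂ (V i)] (ρ : ∀ i, E →+* Module.End ℂ (V i)) (m : ℕ) :
    Iso (directSum fun i => multiple m (ρ i)) (multiple m (directSum ρ)) :=
  ⟨{ toFun := fun f j i => f i j
     invFun := fun f i j => f j i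
     map_add' := fun _ _ => rfl
     map_smul' := fun _ _ => rfl }, fun _ _ => rfl⟩

theorem finrank_multiple [FiniteDimensional ℂ V] (m : ℕ) :
    Module.finrank ℂ (Fin m → V) = m * Module.finrank ℂ V := by
  rw [Module.finrank_pi_fintype, Finset.sum_const, Finset.card_univ, Fintype.card_fin, smul_eq_mul]

theorem trace_directSum {ι : Type*} [Fintype ι] {V : ι → Type*} [∀ i, AddCommGroup (V i)]
    [∀ i, Module ℂ (V i)] [∀ i, FiniteDimensional ℂ (V i)]
    (f : Module.End ℂ (∀ i, V i)) (g : ∀ i, Module.End ℂ (V i)) (h : ∀ y i, f y i = g i (y i)) :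
    LinearMap.trace ℂ _ f = ∑ i, LinearMap.trace ℂ _ (g i) := by
  classical
  have h1 : f = ∑ i, (LinearMap.single ℂ V i ∘ₗ g i) ∘ₗ LinearMap.proj i := by
    refine LinearMap.ext fun y => ?_
    simp only [LinearMap.sum_apply, LinearMap.comp_apply, LinearMap.proj_apply,
      LinearMap.single_apply]
    refine funext fun i => ?_
    rw [Finset.sum_apply, Finset.sum_eq_single i]
    · simp [h]
    · intro j _ hj; simp [Pi.single_eq_of_ne (Ne.symm hj)]
    · simp
  rw [h1, map_sum]
  refine Finset.sum_congr rfl fun i _ => ?_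
  rw [LinearMap.trace_comp_comm']
  congr 1
  ext y
  simp

theorem charpoly_multiple [FiniteDimensional ℂ V] (m : ℕ) (ρ : E →+* Module.End ℂ V) (x : E) :
    (multiple m ρ x).charpoly = (ρ x).charpoly ^ m := by
  induction m with
  | zero =>
    rw [pow_zero]
    exact (LinearMap.charpoly_monic _).natDegree_eq_zero.1 (by
      rw [LinearMap.charpoly_natDegree, finrank_multiple, zero_mul])
  | succ m ih =>
    rw [pow_succ', ← ih, ← LinearMap.charpoly_prodMap]
    let e : (V × (Fin m → V)) ≃ₗ[ℂ] (Fin (m + 1) → V) := Fin.consLinearEquiv ℂ fun _ => V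
    rw [← LinearEquiv.charpoly_conj e]
    congr 1
    refine LinearMap.ext fun y => ?_
    obtain ⟨y, rfl⟩ := e.surjective y
    rw [LinearEquiv.conj_apply_apply, e.symm_apply_apply]
    refine funext fun i => ?_
    refine Fin.cases ?_ (fun i => ?_) i <;> rfl

theorem isRational_multiple [FiniteDimensional ℂ V] (m : ℕ) (h : IsRational ρ) :
    IsRational (multiple m ρ) := fun x => by
  obtain ⟨p, hp⟩ := h x
  exact ⟨p ^ m, by rw [charpoly_multiple, hp, Polynomial.map_pow]⟩

theorem IsRational.exists_trace_eq [FiniteDimensional ℂ V] (h : IsRational ρ) (x : E) :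
    ∃ q : ℚ, LinearMap.trace ℂ V (ρ x) = q := by
  obtain ⟨p, hp⟩ := h x
  refine ⟨-p.nextCoeff, ?_⟩
  let b := Module.finBasis ℂ V
  rw [LinearMap.trace_eq_matrix_trace ℂ b, Matrix.trace_eq_neg_charpoly_nextCoeff,
    LinearMap.charpoly_toMatrix, hp, Polynomial.nextCoeff_map (algebraMap ℚ ℂ).injective]
  simp

/-- Transport of a representation along a linear isomorphism. -/
def transport (ρ : E →+* Module.End ℂ V) (e : V ≃ₗ[ℂ] W) : E →+* Module.End ℂ W :=
  (e.conjRingEquiv : Module.End ℂ V →+* Module.End ℂ W).comp ρ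

theorem iso_transport (ρ : E →+* Module.End ℂ V) (e : V ≃ₗ[ℂ] W) : Iso ρ (transport ρ e) :=
  ⟨e, fun x y => by
    change _ = e.conj (ρ x) (e y)
    rw [LinearEquiv.conj_apply_apply, e.symm_apply_apply]⟩

end Basic

/-! ### Invariant bilinear forms -/

section Forms

variable {E : Type*} [Ring E] [Algebra ℚ E] (τ : PositiveInvolution E)
variable {V : Type*} [AddCommGroup V] [Module ℂ V] {W : Type*} [AddCommGroup W] [Module ℂ W]

/-- A bilinear form for which `τ x` is the adjoint of `x`. -/
def IsInvariant (ρ : E →+* Module.End ℂ V) (B : LinearMap.BilinForm ℂ V) : Prop :=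
  ∀ (x : E) (y z : V), B (ρ x y) z = B y (ρ (τ.toLin x) z)

variable {τ} {ρ : E →+* Module.End ℂ V} {θ : E →+* Module.End ℂ W}

theorem isPolarized_iff : IsPolarized τ ρ ↔
    ∃ B : LinearMap.BilinForm ℂ V, B.IsAlt ∧ B.Nondegenerate ∧ IsInvariant τ ρ B := by
  refine exists_congr fun B => and_congr_right fun _ => and_congr_right fun _ =>
    forall_congr' fun x => forall_congr' fun y => ?_
  rw [LinearMap.ext_iff]
  rfl

theorem IsInvariant.apply_left {B : LinearMap.BilinForm ℂ V} (h : IsInvariant τ ρ B) (x : E)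
    (y z : V) : B (ρ (τ.toLin x) y) z = B y (ρ x z) := by
  rw [h, τ.invol]

theorem IsInvariant.flip {B : LinearMap.BilinForm ℂ V} (h : IsInvariant τ ρ B) :
    IsInvariant τ ρ (LinearMap.flip B) := fun x y z => (h.apply_left x z y).symm

/-- Pullback of a bilinear form. -/
def pullback (B : LinearMap.BilinForm ℂ W) (f g : V →ₗ[ℂ] W) : LinearMap.BilinForm ℂ V :=
  B.compl₁₂ f g

theorem pullback_apply (B : LinearMap.BilinForm ℂ W) (f g : V →ₗ[ℂ] W) (y z : V) :
    pullback B f g y z = B (f y) (g z) := rfl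

theorem IsInvariant.pullback {B : LinearMap.BilinForm ℂ W} (h : IsInvariant τ θ B)
    {f g : V →ₗ[ℂ] W} (hf : ∀ x y, f (ρ x y) = θ x (f y)) (hg : ∀ x y, g (ρ x y) = θ x (g y)) :
    IsInvariant τ ρ (pullback B f g) := fun x y z => by
  rw [pullback_apply, pullback_apply, hf, hg, h]

theorem Iso.isPolarized (h : Iso ρ θ) (hρ : IsPolarized τ ρ) : IsPolarized τ θ := by
  obtain ⟨e, he⟩ := h.symm
  rw [isPolarized_iff] at hρ ⊢
  obtain ⟨B, h1, h2, h3⟩ := hρ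
  exact ⟨RatRep.pullback B e e, fun y => h1 _,
    LinearMap.BilinForm.Nondegenerate.congr e.symm h2, h3.pullback he he⟩

/-- An isomorphism with the dual is a nondegenerate invariant form. -/
theorem exists_isInvariant_of_iso_dualRep [FiniteDimensional ℂ V] (h : Iso ρ (dualRep τ ρ)) :
    ∃ B : LinearMap.BilinForm ℂ V, B.Nondegenerate ∧ IsInvariant τ ρ B := by
  obtain ⟨e, he⟩ := h
  refine ⟨e, ?_, fun x y z => LinearMap.congr_fun (he x y) z⟩
  refine LinearMap.BilinForm.nondegenerate_iff_ker_eq_bot.2 ?_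
  exact LinearMap.ker_eq_bot.2 e.injective

/-- The hyperbolic form on the double of a self-dual representation. -/
theorem isPolarized_multiple_two [FiniteDimensional ℂ V] {B : LinearMap.BilinForm ℂ V}
    (h : B.Nondegenerate) (hB : IsInvariant τ ρ B) : IsPolarized τ (multiple 2 ρ) := by
  let p (i : Fin 2) : (Fin 2 → V) →ₗ[ℂ] V := LinearMap.proj i
  let B' : LinearMap.BilinForm ℂ (Fin 2 → V) :=
    RatRep.pullback B (p 0) (p 1) - LinearMap.flip (RatRep.pullback B (p 0) (p 1))
  have hB' (y z) : B' y z = B (y 0) (z 1) - B (z 0) (y 1) := rfl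
  have halt : B'.IsAlt := fun y => by rw [hB', sub_self]
  refine isPolarized_iff.2 ⟨B', halt, ?_, fun x y z => ?_⟩
  · refine LinearMap.BilinForm.Nondegenerate.ofSeparatingLeft fun y hy => ?_
    have h0 : y 0 = 0 := h.1 _ fun z => by simpa [hB'] using hy (Pi.single 1 z)
    have h1 : y 1 = 0 := h.2 _ fun z => by simpa [hB'] using hy (Pi.single 0 z)
    funext i
    fin_cases i <;> assumption
  · rw [hB', hB']
    simp only [multiple_apply]
    rw [hB, hB.apply_left]

theorem isRational_dualRep [FiniteDimensional ℂ V] (h : IsRational ρ) :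
    IsRational (dualRep τ ρ) := fun x => by
  obtain ⟨p, hp⟩ := h (τ.toLin x)
  refine ⟨p, ?_⟩
  rw [← hp]
  change ((ρ (τ.toLin x)).dualMap).charpoly = _
  let b := Module.finBasis ℂ V
  rw [← LinearMap.charpoly_toMatrix _ b.dualBasis, ← LinearMap.charpoly_toMatrix _ b,
    LinearMap.dualMap_def, LinearMap.toMatrix_transpose, Matrix.charpoly_transpose]

end Forms

/-! ### Schur's lemma -/

section Schur

variable {E : Type*} [Ring E] {V : Type*} [AddCommGroup V] [Module ℂ V] [FiniteDimensional ℂ V]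
  {ρ : E →+* Module.End ℂ V}

/-- An eigenspace of an equivariant endomorphism is invariant and nonzero, hence everything. -/
theorem IsSimple.exists_eq_smul (h : IsSimple ρ) (g : Module.End ℂ V)
    (hg : ∀ x y, g (ρ x y) = ρ x (g y)) : ∃ c : ℂ, ∀ y, g y = c • y := by
  have := h.1
  obtain ⟨c, hc⟩ := Module.End.exists_eigenvalue g
  refine ⟨c, fun y => ?_⟩
  have htop : Module.End.eigenspace g c = ⊤ := by
    refine (h.2 _ fun x y hy => ?_).resolve_left hc
    rw [Module.End.mem_eigenspace_iff] at hy ⊢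
    rw [hg, hy, map_smul]
  exact Module.End.mem_eigenspace_iff.1 (htop ▸ Submodule.mem_top)

/-- Composing one form with the inverse of the nondegenerate one gives an equivariant endomorphism,
to which Schur's lemma applies. -/
theorem IsSimple.exists_form_eq_smul [Algebra ℚ E] {τ : PositiveInvolution E} (h : IsSimple ρ)
    {B B' : LinearMap.BilinForm ℂ V} (hB : B.Nondegenerate) (hiB : IsInvariant τ ρ B)
    (hiB' : IsInvariant τ ρ B') : ∃ c : ℂ, ∀ y z, B' y z = c * B y z := by
  have hker : LinearMap.ker B = ⊥ := LinearMap.BilinForm.nondegenerate_iff_ker_eq_bot.1 hB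
  let e : V ≃ₗ[ℂ] Module.Dual ℂ V :=
    LinearEquiv.ofInjectiveOfFinrankEq B (LinearMap.ker_eq_bot.1 hker)
      Subspace.dual_finrank_eq.symm
  have he (y z) : e y z = B y z := rfl
  have hee (f : Module.Dual ℂ V) (z) : B (e.symm f) z = f z := by
    rw [← he, e.apply_symm_apply]
  obtain ⟨c, hc⟩ := h.exists_eq_smul (e.symm.toLinearMap ∘ₗ B') fun x y => by
    refine LinearMap.ker_eq_bot.1 hker (LinearMap.ext fun z => ?_)
    simp only [LinearMap.comp_apply, LinearEquiv.coe_coe]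
    rw [hiB, hee, hee, hiB']
  refine ⟨c, fun y z => ?_⟩
  have := hee (B' y) z
  rw [← this]
  have h2 : e.symm (B' y) = c • y := hc y
  rw [h2, map_smul]
  rfl

end Schur

end RatRep

namespace RatRep

/-! ### Burnside's theorem -/

section Burnside

variable {E : Type*} [Ring E] {V : Type*} [AddCommGroup V] [Module ℂ V]
  (ρ : E →+* Module.End ℂ V)

theorem mem_span_range_mul {f g : Module.End ℂ V} (hf : f ∈ Submodule.span ℂ (Set.range ρ))
    (hg : g ∈ Submodule.span ℂ (Set.range ρ)) : f * g ∈ Submodule.span ℂ (Set.range ρ) := by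
  have h := Submodule.mul_mem_mul hf hg
  rw [Submodule.span_mul_span] at h
  refine Submodule.span_mono ?_ h
  rintro _ ⟨_, ⟨x, rfl⟩, _, ⟨y, rfl⟩, rfl⟩
  exact ⟨x * y, map_mul ρ x y⟩

theorem one_mem_span_range : (1 : Module.End ℂ V) ∈ Submodule.span ℂ (Set.range ρ) :=
  Submodule.subset_span ⟨1, map_one ρ⟩

/-- The complex algebra generated by a representation. -/
def spanSubalgebra : Subalgebra ℂ (Module.End ℂ V) where
  carrier := Submodule.span ℂ (Set.range ρ)
  mul_mem' := mem_span_range_mul ρ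
  add_mem' := Submodule.add_mem _
  algebraMap_mem' c := by
    rw [Algebra.algebraMap_eq_smul_one]
    exact Submodule.smul_mem _ c (one_mem_span_range ρ)

variable {ρ}

/-- By Schur's lemma the commutant is `ℂ`, so Jacobson density on a basis produces every
endomorphism. -/
theorem IsSimple.span_range_eq_top [FiniteDimensional ℂ V] (h : IsSimple ρ) :
    Submodule.span ℂ (Set.range ρ) = ⊤ := by
  let S := spanSubalgebra ρ
  have hS (x : E) : ρ x ∈ S := Submodule.subset_span ⟨x, rfl⟩
  have := h.1
  have hsimple : IsSimpleModule S V := by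
    refine isSimpleModule_iff_toSpanSingleton_surjective.2 ⟨inferInstance, fun y hy z => ?_⟩
    have h1 : (LinearMap.range (LinearMap.toSpanSingleton S V y)).restrictScalars ℂ = ⊤ := by
      refine (h.2 _ fun x w hw => ?_).resolve_left fun hbot => hy ?_
      · exact Submodule.smul_mem (LinearMap.range (LinearMap.toSpanSingleton S V y))
          (⟨ρ x, hS x⟩ : S) hw
      · have : y ∈ (LinearMap.range (LinearMap.toSpanSingleton S V y)).restrictScalars ℂ :=
          ⟨1, by simp⟩
        rw [hbot] at this
        exact this
    have : z ∈ (LinearMap.range (LinearMap.toSpanSingleton S V y)).restrictScalars ℂ := by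
      rw [h1]; trivial
    exact this
  refine eq_top_iff.2 fun φ _ => ?_
  let F : Module.End (Module.End S V) V :=
    { toFun := φ
      map_add' := φ.map_add
      map_smul' := fun f y => by
        obtain ⟨c, hc⟩ := h.exists_eq_smul
          ({ toFun := f, map_add' := f.map_add
             map_smul' := fun c y => by
              exact f.map_smul (algebraMap ℂ S c) y } : Module.End ℂ V)
          (fun x y => f.map_smul (⟨ρ x, hS x⟩ : S) y)
        have hc' : ∀ y, f y = c • y := hc
        simp only [Module.End.smul_def, hc', map_smul, RingHom.id_apply] }
  let b := Module.finBasis ℂ V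
  classical
  obtain ⟨r, hr⟩ := jacobson_density (R := S) F (Finset.univ.image b)
  have : φ = r := b.ext fun i => hr (b i) (by simp)
  rw [this]
  exact r.2

end Burnside

/-! ### Representations on which the center acts by scalars -/

section ScalarExt

variable {E : Type u} [Ring E] [Algebra ℚ E]
variable {V : Type v} [AddCommGroup V] [Module ℂ V] (ρ : E →+* Module.End ℂ V)

/-- A representation on which the center acts through `σ` extends to `ℂ ⊗_F E`. -/
theorem exists_extension {σ : Center E →ₐ[ℚ] ℂ} (h : ∀ z : Center E, ρ z = σ z • 1) :
    ∃ φ : ScalarExt σ →ₐ[ℂ] Module.End ℂ V, ∀ x, φ (ScalarExt.incl σ x) = ρ x := by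
  let : Algebra (CAlong σ) (Module.End ℂ V) := inferInstanceAs (Algebra ℂ (Module.End ℂ V))
  let : Algebra (Center E) (Module.End ℂ V) :=
    Algebra.compHom (Module.End ℂ V) (algebraMap (Center E) (CAlong σ))
  have : IsScalarTower (Center E) (CAlong σ) (Module.End ℂ V) :=
    IsScalarTower.of_algebraMap_eq fun _ => rfl
  let g : E →ₐ[Center E] Module.End ℂ V :=
    { ρ with
      commutes' := fun z => by
        refine (h z).trans ?_
        rw [← Algebra.algebraMap_eq_smul_one]
        rfl }
  let φ : CAlong σ ⊗[Center E] E →ₐ[CAlong σ] Module.End ℂ V :=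
    Algebra.TensorProduct.lift (Algebra.ofId (CAlong σ) (Module.End ℂ V)) g
      (fun c x => Algebra.commutes c (g x))
  let φ' : ScalarExt σ →ₐ[ℂ] Module.End ℂ V := { φ with commutes' := φ.commutes }
  refine ⟨φ', fun x => ?_⟩
  change φ (1 ⊗ₜ x) = ρ x
  refine (Algebra.TensorProduct.lift_tmul _ _ _ _ _).trans ?_
  rw [map_one, one_mul]
  rfl

variable [FiniteDimensional ℚ E] [IsSimpleRing E]

instance (σ : Center E →ₐ[ℚ] ℂ) : IsSimpleRing (ScalarExt σ) :=
  let : Field (Center E) := (isField_center E).toField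
  have : Algebra.IsCentral (Center E) E := ⟨fun x hx => by
    refine Algebra.mem_bot.2 ⟨⟨x, ?_⟩, rfl⟩
    exact Subalgebra.mem_center_iff.2 (Subalgebra.mem_center_iff.1 hx)⟩
  isSimpleRing_tensorProduct (K := Center E) (A := E) (CAlong σ)

instance (σ : Center E →ₐ[ℚ] ℂ) : IsArtinianRing (ScalarExt σ) :=
  IsArtinianRing.of_finite ℂ (ScalarExt σ)

theorem finrank_scalarExt (σ : Center E →ₐ[ℚ] ℂ) :
    Module.finrank ℂ (ScalarExt σ) = Module.finrank (Center E) E :=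
  let : Field (Center E) := (isField_center E).toField
  Module.finrank_baseChange (R := CAlong σ) (S := Center E) (M' := E)

/-- The map `ℂ ⊗_F E → End V_σ` is injective because the source is simple, and surjective by
Burnside. -/
theorem finrank_simpleSpace_sq (σ : Center E →ₐ[ℚ] ℂ) :
    Module.finrank ℂ (SimpleSpace σ) ^ 2 = Module.finrank (Center E) E := by
  have hsimple := isSimple_simpleRep σ
  obtain ⟨φ, hφ⟩ := exists_extension (simpleRep σ) (σ := σ)
    (fun z => LinearMap.ext fun y => simpleRep_center σ z y)
  have := hsimple.1
  have hinj : Function.Injective φ :=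
    RingHom.injective (φ : ScalarExt σ →+* Module.End ℂ (SimpleSpace σ))
  have hsurj : Function.Surjective φ := by
    refine (LinearMap.range_eq_top (f := φ.toLinearMap)).1 ?_
    rw [eq_top_iff, ← hsimple.span_range_eq_top,
      Submodule.span_le]
    rintro _ ⟨x, rfl⟩
    exact ⟨ScalarExt.incl σ x, hφ x⟩
  have h := (LinearEquiv.ofBijective φ.toLinearMap ⟨hinj, hsurj⟩).finrank_eq
  rw [finrank_scalarExt, Module.finrank_linearMap] at h
  rw [h, sq]

theorem finrank_simpleSpace_eq (σ σ' : Center E →ₐ[ℚ] ℂ) :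
    Module.finrank ℂ (SimpleSpace σ) = Module.finrank ℂ (SimpleSpace σ') :=
  Nat.pow_left_injective (n := 2) (by norm_num)
    ((finrank_simpleSpace_sq σ).trans (finrank_simpleSpace_sq σ').symm)

/-- A representation on which the center acts through `σ` is a multiple of `V_σ`. -/
theorem exists_iso_multiple_simpleRep [FiniteDimensional ℂ V] {σ : Center E →ₐ[ℚ] ℂ}
    (h : ∀ z : Center E, ρ z = σ z • 1) : ∃ m : ℕ, Iso ρ (multiple m (simpleRep σ)) := by
  obtain ⟨φ, hφ⟩ := exists_extension ρ h
  let : Module (ScalarExt σ) V := Module.compHom V (φ : ScalarExt σ →+* Module.End ℂ V)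
  have hsmul (t : ScalarExt σ) (y : V) : t • y = φ t y := rfl
  have : IsScalarTower ℂ (ScalarExt σ) V := IsScalarTower.of_algebraMap_smul fun c y => by
    rw [hsmul, AlgHom.commutes]; rfl
  have : Module.Finite (ScalarExt σ) V := Module.Finite.of_restrictScalars_finite ℂ _ _
  have hS : IsSimpleModule (ScalarExt σ) (SimpleSpace σ) :=
    isSimpleModule_iff_isCoatom.2 (maxLeftIdeal_isMaximal σ).out
  -- Over a semisimple ring each simple module is a left ideal, and in a simple Artinian ring the
  -- simple left ideals are all isomorphic.
  have hiso : IsIsotypicOfType (ScalarExt σ) V (SimpleSpace σ) := by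
    intro m hm
    obtain ⟨I, ⟨eI⟩⟩ := IsSemisimpleRing.exists_linearEquiv_ideal_of_isSimpleModule
      (R := ScalarExt σ) (M := m)
    obtain ⟨J, ⟨eJ⟩⟩ := IsSemisimpleRing.exists_linearEquiv_ideal_of_isSimpleModule
      (R := ScalarExt σ) (M := SimpleSpace σ)
    have : IsSimpleModule (ScalarExt σ) I := IsSimpleModule.congr eI.symm
    have : IsSimpleModule (ScalarExt σ) J := IsSimpleModule.congr eJ.symm
    obtain ⟨e⟩ := IsSimpleRing.isIsotypic (ScalarExt σ) (ScalarExt σ) J I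
    exact ⟨eI.trans (e.trans eJ.symm)⟩
  obtain ⟨m, ⟨e⟩⟩ := hiso.linearEquiv_fun
  refine ⟨m, e.restrictScalars ℂ, fun x y => ?_⟩
  have := e.map_smul (ScalarExt.incl σ x) y
  rw [hsmul, hφ] at this
  exact this

/-- A representation of the right dimension on which the center acts through `σ` is `V_σ`. -/
theorem iso_simpleRep_of_finrank_eq [FiniteDimensional ℂ V] {σ : Center E →ₐ[ℚ] ℂ}
    (h : ∀ z : Center E, ρ z = σ z • 1)
    (hd : Module.finrank ℂ V ^ 2 = Module.finrank (Center E) E) : Iso ρ (simpleRep σ) := by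
  obtain ⟨m, hm⟩ := exists_iso_multiple_simpleRep ρ h
  have h1 := hm.finrank_eq
  have hN := finrank_simpleSpace_sq σ
  have := (isSimple_simpleRep σ).1
  have hpos : 0 < Module.finrank ℂ (SimpleSpace σ) := Module.finrank_pos
  have h2 : Module.finrank ℂ V = Module.finrank ℂ (SimpleSpace σ) :=
    Nat.pow_left_injective (n := 2) (by norm_num) (hd.trans hN.symm)
  rw [finrank_multiple, h2] at h1
  have : m = 1 := by
    have := Nat.eq_of_mul_eq_mul_right hpos ((one_mul _).trans h1)
    exact this.symm
  subst this
  exact hm.trans (iso_multiple_one _).symm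

end ScalarExt

end RatRep

namespace RatRep

/-! ### The embeddings of a number field -/

section NumberField

variable {F : Type*} [Field F] [Algebra ℚ F] [FiniteDimensional ℚ F] [Fintype (F →ₐ[ℚ] ℂ)]

/-- The idempotents of a complex algebra that contains a number field. -/
theorem exists_idempotents {A : Type*} [Ring A] [Algebra ℂ A] (ρ : F →+* A) :
    ∃ e : (F →ₐ[ℚ] ℂ) → A, ∑ σ, e σ = 1 ∧ (∀ σ z, ρ z * e σ = σ z • e σ) ∧
      ∀ σ, e σ ∈ Submodule.span ℂ (Set.range ρ) := by
  classical
  have := Algebra.IsAlgebraic.isSeparable_of_perfectField (K := ℚ) (L := F)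
  let pb := Field.powerBasisOfFiniteOfSeparable ℚ F
  let ν : (F →ₐ[ℚ] ℂ) → ℂ := fun σ => σ pb.gen
  have hν : Function.Injective ν := fun σ σ' h => pb.algHom_ext h
  let g := (minpoly ℚ pb.gen).map (algebraMap ℚ ℂ)
  have hg0 : g ≠ 0 := (Polynomial.map_ne_zero_iff (algebraMap ℚ ℂ).injective).2
    (minpoly.ne_zero pb.isIntegral_gen)
  let : Algebra ℚ A := Algebra.compHom A (algebraMap ℚ ℂ)
  have : IsScalarTower ℚ ℂ A := IsScalarTower.of_algebraMap_eq fun _ => rfl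
  let ρ' : F →ₐ[ℚ] A := ρ.toRatAlgHom
  -- Each root of the minimal polynomial is the image of the generator under some embedding, and
  -- these roots are simple by separability.
  have hdvd : g ∣ Lagrange.nodal Finset.univ ν := by
    refine (IsAlgClosed.splits g).dvd_of_roots_le_roots hg0 ?_
    have hsep : g.Separable := 
      Polynomial.Separable.map (Algebra.IsSeparable.isSeparable ℚ pb.gen)
    refine (Multiset.le_iff_subset (Polynomial.nodup_roots hsep)).2 fun r hr => ?_
    rw [Polynomial.mem_roots hg0, Polynomial.IsRoot.def, Polynomial.eval_map_algebraMap] at hr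
    rw [Polynomial.mem_roots Lagrange.nodal_ne_zero, Polynomial.IsRoot.def]
    have : ν (pb.lift r hr) = r := pb.lift_gen r hr
    rw [← this]
    exact Lagrange.eval_nodal_at_node (Finset.mem_univ _)
  have hnodal : Polynomial.aeval (ρ pb.gen) (Lagrange.nodal Finset.univ ν) = 0 := by
    obtain ⟨q, hq⟩ := hdvd
    have h0 : Polynomial.aeval (ρ pb.gen) g = 0 := by
      rw [Polynomial.aeval_map_algebraMap]
      have := Polynomial.aeval_algHom_apply ρ' pb.gen (minpoly ℚ pb.gen)
      rw [minpoly.aeval, map_zero] at this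
      exact this
    rw [hq, map_mul, h0, zero_mul]
  -- Lagrange interpolation at the conjugates of the generator: the basis polynomials sum to `1`,
  -- and `(X - ν σ)` times the one attached to `σ` is a multiple of the nodal polynomial, which
  -- kills `ρ pb.gen`.
  refine ⟨fun σ => Polynomial.aeval (ρ pb.gen) (Lagrange.basis Finset.univ ν σ), ?_, ?_, ?_⟩
  · have : Nonempty (F →ₐ[ℚ] ℂ) := ⟨IsAlgClosed.lift⟩
    rw [← map_sum, Lagrange.sum_basis hν.injOn Finset.univ_nonempty, map_one]
  · intro σ z
    have hgen : ρ pb.gen * Polynomial.aeval (ρ pb.gen) (Lagrange.basis Finset.univ ν σ) =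
        ν σ • Polynomial.aeval (ρ pb.gen) (Lagrange.basis Finset.univ ν σ) := by
      have h1 : Lagrange.nodal Finset.univ ν ∣
          (Polynomial.X - Polynomial.C (ν σ)) * Lagrange.basis Finset.univ ν σ := by
        rw [Lagrange.nodal_eq_mul_nodal_erase (Finset.mem_univ σ)]
        refine mul_dvd_mul_left _ ?_
        rw [Lagrange.nodal_eq]
        refine Finset.prod_dvd_prod_of_dvd _ _ fun j _ => ?_
        exact dvd_mul_left _ _
      obtain ⟨q, hq⟩ := h1
      have h2 := congrArg (Polynomial.aeval (ρ pb.gen)) hq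
      rw [map_mul, map_mul, hnodal, zero_mul, map_sub, Polynomial.aeval_X, Polynomial.aeval_C,
        sub_mul, sub_eq_zero, ← Algebra.smul_def] at h2
      exact h2
    set y := Polynomial.aeval (ρ pb.gen) (Lagrange.basis Finset.univ ν σ)
    obtain ⟨f, rfl⟩ := pb.exists_eq_aeval' z
    induction f using Polynomial.induction_on' with
    | add p q hp hq => simp only [map_add, add_mul, add_smul, hp, hq]
    | monomial n c =>
      rw [Polynomial.aeval_monomial, map_mul, map_mul, AlgHom.commutes, map_pow, map_pow, mul_smul,
        mul_assoc]
      have h1 : ρ pb.gen ^ n * y = ν σ ^ n • y := by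
        induction n with
        | zero => simp
        | succ n ih => rw [pow_succ, mul_assoc, hgen, mul_smul_comm, ih, smul_smul, pow_succ']
      rw [h1]
      have h2 : ρ (algebraMap ℚ F c) = algebraMap ℂ A (algebraMap ℚ ℂ c) := by
        rw [eq_ratCast, eq_ratCast]
        have := ρ'.commutes c
        rw [eq_ratCast] at this
        refine this.trans ?_
        rw [IsScalarTower.algebraMap_apply ℚ ℂ A, eq_ratCast]
      rw [h2, ← Algebra.smul_def]
  · intro σ
    beta_reduce
    rw [Polynomial.aeval_eq_sum_range]
    refine Submodule.sum_mem _ fun i _ => Submodule.smul_mem _ _ (Submodule.subset_span ?_)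
    exact ⟨pb.gen ^ i, map_pow ρ _ _⟩

/-- A rational linear combination of the embeddings is the trace form of an element. -/
theorem exists_eq_embedding (c : (F →ₐ[ℚ] ℂ) → ℂ) (h : ∀ z, ∃ q : ℚ, ∑ σ, c σ * σ z = q) :
    ∃ a : F, ∀ σ, c σ = σ a := by
  have := Algebra.IsAlgebraic.isSeparable_of_perfectField (K := ℚ) (L := F)
  choose l hl using h
  let L : F →ₗ[ℚ] ℚ :=
    { toFun := l
      map_add' := fun x y => by
        have : ((l (x + y) : ℚ) : ℂ) = (l x + l y : ℚ) := by
          push_cast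
          rw [← hl, ← hl, ← hl, ← Finset.sum_add_distrib]
          exact Finset.sum_congr rfl fun σ _ => by rw [map_add, mul_add]
        exact_mod_cast this
      map_smul' := fun q x => by
        have : ((l (q • x) : ℚ) : ℂ) = (q * l x : ℚ) := by
          push_cast
          rw [← hl, ← hl, Finset.mul_sum]
          refine Finset.sum_congr rfl fun σ _ => ?_
          rw [map_smul, Rat.smul_def]
          ring
        exact_mod_cast this }
  -- The rational functional is `z ↦ Tr(a z) = ∑ σ(a) σ(z)`. Linear independence of the embeddings
  -- then identifies the coefficients.
  obtain ⟨a, ha⟩ := (LinearMap.BilinForm.toDual _ (traceForm_nondegenerate ℚ F)).surjective L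
  refine ⟨a, ?_⟩
  have hli := linearIndependent_toLinearMap ℚ F ℂ
  have hsum : ∑ σ : F →ₐ[ℚ] ℂ, (c σ - σ a) • σ.toLinearMap = 0 := by
    refine LinearMap.ext fun z => ?_
    have h1 : Algebra.trace ℚ F (a * z) = l z := LinearMap.congr_fun ha z
    have h2 := trace_eq_sum_embeddings (K := ℚ) (L := F) ℂ (x := a * z)
    rw [h1, eq_ratCast, ← hl] at h2
    simp only [LinearMap.sum_apply, LinearMap.smul_apply, AlgHom.toLinearMap_apply, smul_eq_mul,
      sub_mul, Finset.sum_sub_distrib, LinearMap.zero_apply]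
    rw [h2, sub_eq_zero]
    convert Finset.sum_congr rfl fun σ _ => map_mul (σ : F →ₐ[ℚ] ℂ) a z
  exact fun σ => sub_eq_zero.1 (Fintype.linearIndependent_iff.1 hli _ hsum σ)

/-- A rational combination of the embeddings with natural coefficients is a multiple of the
trace. -/
theorem eq_of_sum_embeddings_rational (m : (F →ₐ[ℚ] ℂ) → ℕ) {N : ℕ} (hN : N ≠ 0)
    (h : ∀ z, ∃ q : ℚ, ∑ σ, ((m σ * N : ℕ) : ℂ) * σ z = q) (σ σ' : F →ₐ[ℚ] ℂ) : m σ = m σ' := by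
  obtain ⟨a, ha⟩ := exists_eq_embedding _ h
  -- The coefficient `σ a` is a natural number, so `a` is that number and has the same image under
  -- every embedding.
  have h1 : a = ((m σ * N : ℕ) : F) := σ.toRingHom.injective (by
    change σ a = σ _
    rw [← ha, map_natCast])
  have h2 := ha σ'
  rw [h1, map_natCast] at h2
  exact (Nat.eq_of_mul_eq_mul_right (Nat.pos_of_ne_zero hN) (by exact_mod_cast h2)).symm

end NumberField

/-! ### Classification of representations -/

section Classification

variable {E : Type u} [Ring E] [Algebra ℚ E]
variable {V : Type v} [AddCommGroup V] [Module ℂ V] (ρ : E →+* Module.End ℂ V)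

/-- The restriction of a representation to the center. -/
def centerRep : Center E →+* Module.End ℂ V := ρ.comp (Subalgebra.val _ : Center E →ₐ[ℚ] E)

/-- The part of a representation on which the center acts through `σ`. -/
def isotypicPart (σ : Center E →ₐ[ℚ] ℂ) : Submodule ℂ V where
  carrier := {y | ∀ z : Center E, ρ z y = σ z • y}
  add_mem' h1 h2 z := by rw [map_add, h1, h2, smul_add]
  zero_mem' z := by rw [map_zero, smul_zero]
  smul_mem' c y h z := by rw [map_smul, h, smul_comm]

theorem apply_mem_isotypicPart {σ : Center E →ₐ[ℚ] ℂ} (x : E) {y : V}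
    (hy : y ∈ isotypicPart ρ σ) : ρ x y ∈ isotypicPart ρ σ := fun z => by
  have h : (z : E) * x = x * z := (Subalgebra.mem_center_iff.1 z.2 x).symm
  rw [← Module.End.mul_apply, ← map_mul, h, map_mul, Module.End.mul_apply, hy, map_smul]

/-- The action on the `σ`-part of a representation. -/
def isotypicRep (σ : Center E →ₐ[ℚ] ℂ) : E →+* Module.End ℂ (isotypicPart ρ σ) where
  toFun x := (ρ x).restrict fun _ hy => apply_mem_isotypicPart ρ x hy
  map_one' := by ext; simp
  map_mul' x y := by ext; simp
  map_zero' := by ext; simp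
  map_add' x y := by ext; simp

variable [FiniteDimensional ℚ E] [IsSimpleRing E]

instance : Fintype (Center E →ₐ[ℚ] ℂ) := Fintype.ofFinite _

instance : Nonempty (Center E →ₐ[ℚ] ℂ) :=
  let : Field (Center E) := (isField_center E).toField
  ⟨IsAlgClosed.lift⟩

theorem exists_center_idempotents :
    ∃ e : (Center E →ₐ[ℚ] ℂ) → Module.End ℂ V, ∑ σ, e σ = 1 ∧
      (∀ σ (z : Center E), ρ z * e σ = σ z • e σ) ∧
      ∀ σ, e σ ∈ Submodule.span ℂ (Set.range (centerRep ρ)) :=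
  let : Field (Center E) := (isField_center E).toField
  exists_idempotents (F := Center E) (centerRep ρ)

/-- Each `e σ'` is a complex combination of central elements, so it preserves the `σ`-part. Its
image lies in the `σ'`-part, so it vanishes there when `σ' ≠ σ`. -/
theorem idempotent_apply {e : (Center E →ₐ[ℚ] ℂ) → Module.End ℂ V} (h1 : ∑ σ, e σ = 1)
    (h2 : ∀ σ (z : Center E), ρ z * e σ = σ z • e σ)
    (h3 : ∀ σ, e σ ∈ Submodule.span ℂ (Set.range (centerRep ρ)))
    {σ : Center E →ₐ[ℚ] ℂ} {y : V} (hy : y ∈ isotypicPart ρ σ) :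
    e σ y = y ∧ ∀ σ', σ' ≠ σ → e σ' y = 0 := by
  have hne : ∀ σ', σ' ≠ σ → e σ' y = 0 := by
    intro σ' hσ
    obtain ⟨z, hz⟩ : ∃ z, σ' z ≠ σ z := by
      by_contra! h
      exact hσ (AlgHom.ext h)
    have hcomm : ∀ f ∈ Submodule.span ℂ (Set.range (centerRep ρ)), ρ z (f y) = σ z • f y := by
      intro f hf
      induction hf using Submodule.span_induction with
      | mem f hf =>
        obtain ⟨z', rfl⟩ := hf
        exact apply_mem_isotypicPart ρ z' hy z
      | zero => simp
      | add f g _ _ hf hg => simp only [LinearMap.add_apply, map_add, hf, hg, smul_add]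
      | smul c f _ hf => simp only [LinearMap.smul_apply, map_smul, hf, smul_comm c]
    have h4 := hcomm _ (h3 σ')
    have h5 := LinearMap.congr_fun (h2 σ' z) y
    rw [Module.End.mul_apply, h4, LinearMap.smul_apply] at h5
    by_contra h0
    exact hz (smul_left_injective ℂ h0 h5).symm
  refine ⟨?_, hne⟩
  have h6 := LinearMap.congr_fun h1 y
  rw [LinearMap.sum_apply, Finset.sum_eq_single σ (fun σ' _ h => hne σ' h) (by simp)] at h6
  exact h6

/-- The idempotents provide the inverse of the summation map from the product of the parts. -/
theorem iso_directSum_isotypicRep : Iso ρ (directSum fun σ => isotypicRep ρ σ) := by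
  obtain ⟨e, h1, h2, h3⟩ := exists_center_idempotents ρ
  have hmem (σ) (y : V) : e σ y ∈ isotypicPart ρ σ := fun z => LinearMap.congr_fun (h2 σ z) y
  have hy (σ) (y : isotypicPart ρ σ) := idempotent_apply ρ h1 h2 h3 y.2
  let f : (∀ σ, isotypicPart ρ σ) →ₗ[ℂ] V :=
    ∑ σ, (isotypicPart ρ σ).subtype ∘ₗ LinearMap.proj σ
  have hf (y) : f y = ∑ σ, (y σ : V) := by simp [f]
  have hbij : Function.Bijective f := by
    constructor
    · refine (injective_iff_map_eq_zero f).2 fun y h0 => funext fun σ => Subtype.ext ?_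
      have := congrArg (e σ) h0
      rw [hf, map_sum, Finset.sum_eq_single σ
        (fun σ' _ h => (hy σ' (y σ')).2 σ h.symm) (by simp), (hy σ (y σ)).1, map_zero] at this
      exact this
    · intro y
      refine ⟨fun σ => ⟨e σ y, hmem σ y⟩, ?_⟩
      rw [hf]
      have := LinearMap.congr_fun h1 y
      rwa [LinearMap.sum_apply] at this
  refine Iso.symm ⟨LinearEquiv.ofBijective f hbij, fun x y => ?_⟩
  rw [LinearEquiv.ofBijective_apply, LinearEquiv.ofBijective_apply, hf, hf, map_sum]
  rfl

/-- Every representation is a direct sum of multiples of the `V_σ`. -/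
theorem exists_iso_directSum_multiple [FiniteDimensional ℂ V] :
    ∃ m : (Center E →ₐ[ℚ] ℂ) → ℕ, Iso ρ (directSum fun σ => multiple (m σ) (simpleRep σ)) := by
  have h (σ : Center E →ₐ[ℚ] ℂ) := exists_iso_multiple_simpleRep (isotypicRep ρ σ) (σ := σ)
    (fun z => LinearMap.ext fun y => Subtype.ext (y.2 z))
  choose m hm using h
  exact ⟨m, (iso_directSum_isotypicRep ρ).trans (Iso.directSum hm)⟩

theorem trace_simpleRep_multiple (m : ℕ) (σ : Center E →ₐ[ℚ] ℂ) (z : Center E) :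
    LinearMap.trace ℂ _ (multiple m (simpleRep σ) z) =
      ((m * Module.finrank ℂ (SimpleSpace σ) : ℕ) : ℂ) * σ z := by
  rw [trace_directSum _ (fun _ => simpleRep σ z) (fun _ _ => rfl), Finset.sum_const,
    Finset.card_univ, Fintype.card_fin, trace_simpleRep, nsmul_eq_mul]
  push_cast
  ring

/-- A representation whose central trace is rational is a multiple of `V_r`. -/
theorem exists_iso_multiple_vr [FiniteDimensional ℂ V]
    (h : ∀ z : Center E, ∃ q : ℚ, LinearMap.trace ℂ V (ρ z) = q) :
    ∃ m : ℕ, Iso ρ (multiple m (Vr E)) := by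
  obtain ⟨m, hm⟩ := exists_iso_directSum_multiple ρ
  obtain ⟨σ₀⟩ : Nonempty (Center E →ₐ[ℚ] ℂ) := inferInstance
  have := (isSimple_simpleRep σ₀).1
  have hN : Module.finrank ℂ (SimpleSpace σ₀) ≠ 0 := Module.finrank_pos.ne'
  have hconst : ∀ σ, m σ = m σ₀ := fun σ => by
    let : Field (Center E) := (isField_center E).toField
    refine eq_of_sum_embeddings_rational (F := Center E) m hN (fun z => ?_) σ σ₀
    obtain ⟨q, hq⟩ := h z
    refine ⟨q, ?_⟩
    rw [← hq, hm.trace_eq, trace_directSum _ (fun σ => multiple (m σ) (simpleRep σ) z)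
      (fun _ _ => rfl)]
    refine Finset.sum_congr rfl fun σ _ => ?_
    rw [trace_simpleRep_multiple, finrank_simpleSpace_eq σ σ₀]
  obtain ⟨c, rfl⟩ : ∃ c, m = fun _ => c := ⟨m σ₀, funext hconst⟩
  exact ⟨c, hm.trans (iso_directSum_multiple _ _)⟩

variable (E) in
/-- The complexified regular representation. -/
def regularRep : E →+* Module.End ℂ (ℂ ⊗[ℚ] E) :=
  ((Module.End.baseChangeHom ℚ ℂ E : Module.End ℚ E →ₐ[ℚ] Module.End ℂ (ℂ ⊗[ℚ] E)).comp
    (Algebra.lmul ℚ E) : E →ₐ[ℚ] Module.End ℂ (ℂ ⊗[ℚ] E))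

-- The trace of a left multiplication on `E` is a rational number, so the central trace criterion
-- applies. The multiplicity is nonzero since `E` is.
variable (E) in
theorem exists_iso_regularRep :
    ∃ k : ℕ, k ≠ 0 ∧ Iso (regularRep E) (multiple k (Vr E)) := by
  obtain ⟨k, hk⟩ := exists_iso_multiple_vr (regularRep E) fun z =>
    ⟨_, (LinearMap.trace_baseChange (Algebra.lmul ℚ E (z : E)) ℂ).trans (eq_ratCast _ _)⟩
  refine ⟨k, ?_, hk⟩
  rintro rfl
  have h1 := hk.finrank_eq
  rw [finrank_multiple, zero_mul, Module.finrank_baseChange] at h1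
  exact Module.finrank_pos.ne' h1

variable (E) in
/-- The representation `V_r` is rational. -/
theorem isRational_vr : IsRational (Vr E) := by
  obtain ⟨k, hk0, hk⟩ := exists_iso_regularRep E
  intro x
  -- The `k`-th power of this polynomial is the characteristic polynomial of left multiplication by
  -- `x` on the `ℚ`-space `E`.
  refine (LinearMap.charpoly_monic (Vr E x)).exists_map_of_pow hk0
    (q := (Algebra.lmul ℚ E x).charpoly) ?_
  rw [← charpoly_multiple, ← hk.charpoly_eq]
  exact LinearMap.charpoly_baseChange _ _

-- This carries the positivity of the involution, stated for the trace on `E`, over to traces on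
-- `V_r`.
variable (E) in
theorem exists_trace_eq_trace_vr : ∃ k : ℕ, k ≠ 0 ∧ ∀ x : E,
    (LinearMap.trace ℚ E (LinearMap.mulLeft ℚ x) : ℂ) = k * LinearMap.trace ℂ _ (Vr E x) := by
  obtain ⟨k, hk0, hk⟩ := exists_iso_regularRep E
  refine ⟨k, hk0, fun x => ?_⟩
  have h1 := hk.trace_eq x
  rw [trace_directSum _ (fun _ => Vr E x) (fun _ _ => rfl), Finset.sum_const,
    Finset.card_univ, Fintype.card_fin, nsmul_eq_mul] at h1
  rw [← h1]
  exact ((LinearMap.trace_baseChange (Algebra.lmul ℚ E x) ℂ).trans (eq_ratCast _ _)).symm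

variable (E) in
theorem finrank_vrSpace (σ : Center E →ₐ[ℚ] ℂ) : Module.finrank ℂ (VrSpace E) =
    Module.finrank ℚ (Center E) * Module.finrank ℂ (SimpleSpace σ) := by
  let : Field (Center E) := (isField_center E).toField
  have := Algebra.IsAlgebraic.isSeparable_of_perfectField (K := ℚ) (L := Center E)
  have hc : Nat.card (Center E →ₐ[ℚ] ℂ) = Module.finrank ℚ (Center E) :=
    (@Nat.card_eq_fintype_card _ (minpoly.AlgHom.fintype ℚ (Center E) ℂ)).trans
      (AlgHom.card ℚ (Center E) ℂ)
  rw [Module.finrank_pi_fintype, Finset.sum_congr rfl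
    (fun σ' _ => finrank_simpleSpace_eq σ' σ), Finset.sum_const, smul_eq_mul, ← hc,
    Finset.card_univ, Nat.card_eq_fintype_card]

theorem finrank_vrSpace_pos : 0 < Module.finrank ℂ (VrSpace E) := by
  obtain ⟨σ⟩ : Nonempty (Center E →ₐ[ℚ] ℂ) := inferInstance
  have := (isSimple_simpleRep σ).1
  rw [finrank_vrSpace E σ]
  exact Nat.mul_pos Module.finrank_pos Module.finrank_pos

end Classification

end RatRep

namespace RatRep

/-! ### Polarizability of multiples of `V_r` -/

section Orthogonality

variable {E : Type u} [Ring E] [Algebra ℚ E] (τ : PositiveInvolution E)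

instance : DecidableEq (Center E →ₐ[ℚ] ℂ) := Classical.decEq _

/-- The restriction of an involution to the center. -/
def centerInvolution : Center E →ₐ[ℚ] Center E where
  toFun z := ⟨τ.toLin z, Subalgebra.mem_center_iff.2 fun x => by
    have h := congrArg τ.toLin (Subalgebra.mem_center_iff.1 z.2 (τ.toLin x))
    rw [τ.anti, τ.anti, τ.invol] at h
    exact h.symm⟩
  map_one' := Subtype.ext τ.map_one
  map_mul' x y := Subtype.ext <| by
    change τ.toLin ((x * y : Center E) : E) = τ.toLin x * τ.toLin y
    rw [mul_comm]
    exact τ.anti _ _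
  map_zero' := Subtype.ext (map_zero τ.toLin)
  map_add' x y := Subtype.ext (map_add τ.toLin _ _)
  commutes' q := Subtype.ext <| by
    change τ.toLin (algebraMap ℚ E q) = algebraMap ℚ E q
    rw [Algebra.algebraMap_eq_smul_one, map_smul, τ.map_one]

theorem coe_centerInvolution (z : Center E) : (centerInvolution τ z : E) = τ.toLin z := rfl

theorem centerInvolution_centerInvolution (z : Center E) :
    centerInvolution τ (centerInvolution τ z) = z := Subtype.ext (τ.invol z)

/-- The embedding of the center conjugate to `σ` under the involution. -/
def bar (σ : Center E →ₐ[ℚ] ℂ) : Center E →ₐ[ℚ] ℂ := σ.comp (centerInvolution τ)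

theorem bar_apply (σ : Center E →ₐ[ℚ] ℂ) (z : Center E) : bar τ σ z = σ (centerInvolution τ z) :=
  rfl

theorem bar_bar (σ : Center E →ₐ[ℚ] ℂ) : bar τ (bar τ σ) = σ := AlgHom.ext fun z => by
  rw [bar_apply, bar_apply, centerInvolution_centerInvolution]

variable {τ} {V : Type v} [AddCommGroup V] [Module ℂ V] {ρ : E →+* Module.End ℂ V}

/-- Moving a central `c` across the form multiplies the value by `σ c` on one side and by `bar τ σ'
c` on the other. -/
theorem IsInvariant.apply_eq_zero {B : LinearMap.BilinForm ℂ V} (hB : IsInvariant τ ρ B)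
    {σ σ' : Center E →ₐ[ℚ] ℂ} (h : σ ≠ bar τ σ') {y z : V} (hy : y ∈ isotypicPart ρ σ)
    (hz : z ∈ isotypicPart ρ σ') : B y z = 0 := by
  obtain ⟨c, hc⟩ : ∃ c, σ c ≠ bar τ σ' c := by
    by_contra! h'
    exact h (AlgHom.ext h')
  have h1 := hB c y z
  rw [← coe_centerInvolution, hy, hz, map_smul, map_smul, LinearMap.smul_apply, smul_eq_mul,
    smul_eq_mul, ← bar_apply] at h1
  by_contra h0
  exact hc (mul_right_cancel₀ h0 h1)

theorem map_mem_isotypicPart [IsSimpleRing E] {σ : Center E →ₐ[ℚ] ℂ} {f : SimpleSpace σ →ₗ[ℂ] V}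
    (hf : ∀ x y, f (simpleRep σ x y) = ρ x (f y)) (y : SimpleSpace σ) :
    f y ∈ isotypicPart ρ σ := fun z => by
  rw [← hf, simpleRep_center, map_smul]

theorem vr_single [IsSimpleRing E] (σ : Center E →ₐ[ℚ] ℂ) (x : E) (y : SimpleSpace σ) :
    LinearMap.single ℂ (fun σ : Center E →ₐ[ℚ] ℂ => SimpleSpace σ) σ (simpleRep σ x y) =
      Vr E x (LinearMap.single ℂ (fun σ : Center E →ₐ[ℚ] ℂ => SimpleSpace σ) σ y) :=
  (directSum_single _ x σ y).symm

theorem apply_single_single_eq_zero [IsSimpleRing E] {B : LinearMap.BilinForm ℂ (VrSpace E)}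
    (hB : IsInvariant τ (Vr E) B)
    {σ σ' : Center E →ₐ[ℚ] ℂ} (h : σ ≠ bar τ σ')
    (y : SimpleSpace σ) (z : SimpleSpace σ') : B (Pi.single σ y) (Pi.single σ' z) = 0 :=
  hB.apply_eq_zero h (map_mem_isotypicPart (vr_single σ) y) (map_mem_isotypicPart (vr_single σ') z)

end Orthogonality

/-! ### Signs of invariant forms and parity of the polarized multiples -/

section Dichotomy

variable {E : Type u} [Ring E] [Algebra ℚ E] [FiniteDimensional ℚ E] [IsSimpleRing E]
  (τ : PositiveInvolution E)

/-- The dual of `V_r` is rational, hence a multiple of `V_r`, and comparing dimensions gives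
multiplicity one. -/
theorem exists_isInvariant_vr : ∃ B : LinearMap.BilinForm ℂ (VrSpace E),
    B.Nondegenerate ∧ IsInvariant τ (Vr E) B := by
  obtain ⟨m, hm⟩ := exists_iso_multiple_vr (dualRep τ (Vr E)) fun z =>
    (isRational_dualRep (isRational_vr E)).exists_trace_eq z
  have h := hm.finrank_eq
  rw [finrank_multiple, Subspace.dual_finrank_eq] at h
  obtain rfl : m = 1 :=
    (Nat.eq_of_mul_eq_mul_right finrank_vrSpace_pos ((one_mul _).trans h)).symm
  exact exists_isInvariant_of_iso_dualRep ((iso_multiple_one _).trans hm.symm)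

theorem isPolarized_multiple_two_vr : IsPolarized τ (multiple 2 (Vr E)) := by
  obtain ⟨B, h, hB⟩ := exists_isInvariant_vr τ
  exact isPolarized_multiple_two h hB

/-- The simple representation `V_σ` carries a nondegenerate invariant form of the given sign. -/
def HasForm (σ : Center E →ₐ[ℚ] ℂ) (ε : ℂ) : Prop :=
  ∃ B : LinearMap.BilinForm ℂ (SimpleSpace σ), B.Nondegenerate ∧ IsInvariant τ (simpleRep σ) B ∧
    ∀ y z, B z y = ε * B y z

variable {τ} {B : LinearMap.BilinForm ℂ (VrSpace E)}

theorem apply_single_right (hB : IsInvariant τ (Vr E) B)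
    (σ : Center E →ₐ[ℚ] ℂ) (y : VrSpace E) (z : SimpleSpace (bar τ σ)) :
    B y (Pi.single (bar τ σ) z) = B (Pi.single σ (y σ)) (Pi.single (bar τ σ) z) := by
  conv_lhs => rw [← Finset.univ_sum_single y, map_sum, LinearMap.sum_apply]
  refine Finset.sum_eq_single σ (fun σ' _ h => ?_) (by simp)
  exact apply_single_single_eq_zero hB (by rwa [bar_bar]) _ _

theorem apply_single_left (hB : IsInvariant τ (Vr E) B)
    (σ : Center E →ₐ[ℚ] ℂ) (y : VrSpace E) (z : SimpleSpace (bar τ σ)) :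
    B (Pi.single (bar τ σ) z) y = B (Pi.single (bar τ σ) z) (Pi.single σ (y σ)) := by
  conv_lhs => rw [← Finset.univ_sum_single y, map_sum]
  refine Finset.sum_eq_single σ (fun σ' _ h => ?_) (by simp)
  refine apply_single_single_eq_zero hB (fun h' => h ?_) _ _
  rw [← bar_bar τ σ, h', bar_bar]

theorem eq_zero_of_apply_single_right (hB : IsInvariant τ (Vr E) B)
    (hn : B.Nondegenerate) {σ : Center E →ₐ[ℚ] ℂ}
    {y : SimpleSpace σ} (h : ∀ z, B (Pi.single σ y) (Pi.single (bar τ σ) z) = 0) : y = 0 := by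
  refine Pi.single_eq_zero_iff.1 (hn.1 (Pi.single σ y : VrSpace E) fun z => ?_)
  have h1 := apply_single_left hB (bar τ σ) z
  rw [bar_bar] at h1
  rw [h1, h]

theorem eq_zero_of_apply_single_left (hB : IsInvariant τ (Vr E) B)
    (hn : B.Nondegenerate) {σ : Center E →ₐ[ℚ] ℂ}
    {y : SimpleSpace σ} (h : ∀ z, B (Pi.single (bar τ σ) z) (Pi.single σ y) = 0) : y = 0 := by
  refine Pi.single_eq_zero_iff.1 (hn.2 (Pi.single σ y : VrSpace E) fun z => ?_)
  have h1 := apply_single_right hB (bar τ σ) z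
  rw [bar_bar] at h1
  rw [h1, h]

variable (τ)

/-- When `σ` is self-conjugate, a nondegenerate form on `V_r` stays nondegenerate on `V_σ`. Its flip
is also invariant, hence equals `c` times it, and flipping twice gives `c * c = 1`. -/
theorem hasForm_one_or_neg_one {σ : Center E →ₐ[ℚ] ℂ} (hσ : bar τ σ = σ) :
    HasForm τ σ 1 ∨ HasForm τ σ (-1) := by
  obtain ⟨B, hn, hB⟩ := exists_isInvariant_vr τ
  have hsimple := isSimple_simpleRep σ
  have := hsimple.1
  let B' := pullback B (LinearMap.single ℂ (fun σ : Center E →ₐ[ℚ] ℂ => SimpleSpace σ) σ)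
    (LinearMap.single ℂ (fun σ : Center E →ₐ[ℚ] ℂ => SimpleSpace σ) σ)
  have hB' : IsInvariant τ (simpleRep σ) B' := hB.pullback (vr_single σ) (vr_single σ)
  have hn' : B'.Nondegenerate := by
    refine LinearMap.BilinForm.Nondegenerate.ofSeparatingLeft fun y hy => ?_
    refine eq_zero_of_apply_single_right hB hn (σ := σ) ?_
    rw [hσ]
    exact hy
  obtain ⟨c, hc⟩ := hsimple.exists_form_eq_smul hn' hB' hB'.flip
  have hc' (y z) : B' z y = c * B' y z := hc y z
  obtain ⟨y, z, hyz⟩ : ∃ y z, B' y z ≠ 0 := by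
    by_contra! h
    obtain ⟨y, hy⟩ := exists_ne (0 : SimpleSpace σ)
    exact hy (hn'.1 y (h y))
  have h1 : c * c = 1 := by
    have := hc' z y
    rw [hc' y z, ← mul_assoc] at this
    exact mul_right_cancel₀ hyz (by rw [one_mul]; exact this.symm)
  rcases mul_self_eq_one_iff.1 h1 with rfl | rfl
  · exact Or.inl ⟨B', hn', hB', hc'⟩
  · exact Or.inr ⟨B', hn', hB', hc'⟩

/-- By uniqueness up to scalar, all invariant forms on `V_σ` share the sign of one nondegenerate
form. -/
theorem HasForm.eq {τ : PositiveInvolution E} {σ : Center E →ₐ[ℚ] ℂ} {ε : ℂ} (h : HasForm τ σ ε)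
    {B : LinearMap.BilinForm ℂ (SimpleSpace σ)} (hB : IsInvariant τ (simpleRep σ) B)
    (y z : SimpleSpace σ) : B z y = ε * B y z := by
  obtain ⟨B₀, hn, hB₀, hε⟩ := h
  obtain ⟨c, hc⟩ := (isSimple_simpleRep σ).exists_form_eq_smul hn hB₀ hB
  rw [hc, hc, hε]
  ring

/-- If the self-conjugate `V_σ` carry alternating forms, then `V_r` is polarized. -/
theorem isPolarized_vr (h : ∀ σ : Center E →ₐ[ℚ] ℂ, bar τ σ = σ → HasForm τ σ (-1)) :
    IsPolarized τ (Vr E) := by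
  obtain ⟨B, hn, hB⟩ := exists_isInvariant_vr τ
  let e := Fintype.equivFin (Center E →ₐ[ℚ] ℂ)
  -- An arbitrary enumeration selects one member of each pair `{σ, σ̄}`. Cutting `B` down by `c`
  -- keeps one half of each pairing, so antisymmetrizing cannot cancel it. At a self-conjugate `σ`
  -- the form `B` is already skew, and the result is `2 B`.
  let c : (Center E →ₐ[ℚ] ℂ) → ℂ := fun σ => if e σ ≤ e (bar τ σ) then 1 else 0
  let T : Module.End ℂ (VrSpace E) := LinearMap.pi fun σ => c σ • LinearMap.proj σ
  have hT (y : VrSpace E) (σ) : T y σ = c σ • y σ := rfl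
  have hTs (σ) (z : SimpleSpace σ) : T (Pi.single σ z) = c σ • Pi.single σ z := by
    funext σ'
    rw [hT]
    by_cases h : σ' = σ
    · subst h; simp
    · simp [h]
  have hTρ (x : E) (y) : T (Vr E x y) = Vr E x (T y) := funext fun σ =>
    ((simpleRep σ x).map_smul (c σ) (y σ)).symm
  let B' := pullback B T LinearMap.id
  have hB' : IsInvariant τ (Vr E) B' := hB.pullback hTρ fun _ _ => rfl
  refine isPolarized_iff.2 ⟨B' - LinearMap.flip B', fun y => sub_self _, ?_, fun x y z => ?_⟩
  · refine LinearMap.BilinForm.Nondegenerate.ofSeparatingLeft fun y hy => funext fun σ => ?_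
    have key (z : SimpleSpace (bar τ σ)) :
        c σ * B (Pi.single σ (y σ)) (Pi.single (bar τ σ) z) =
          c (bar τ σ) * B (Pi.single (bar τ σ) z) (Pi.single σ (y σ)) := by
      have h1 : B (T y) (Pi.single (bar τ σ) z) - B (T (Pi.single (bar τ σ) z)) y = 0 :=
        hy (Pi.single (bar τ σ) z)
      rw [apply_single_right hB, hTs, map_smul, LinearMap.smul_apply, apply_single_left hB, hT,
        Pi.single_smul, map_smul, LinearMap.smul_apply, sub_eq_zero] at h1
      exact h1
    by_cases hσ : bar τ σ = σ
    · have hc : c σ = 1 := by simp [c, hσ]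
      refine eq_zero_of_apply_single_right hB hn fun z => ?_
      have h1 := key z
      have h2 := (h σ hσ).eq (hB.pullback (vr_single σ) (vr_single σ))
      have h3 (z : SimpleSpace (bar τ σ)) : B (Pi.single (bar τ σ) z) (Pi.single σ (y σ)) =
          -1 * B (Pi.single σ (y σ)) (Pi.single (bar τ σ) z) := by
        revert z
        rw [hσ]
        exact fun z => h2 (y σ) z
      have hc' : c (bar τ σ) = 1 := by rw [hσ, hc]
      rw [h3, hc, hc'] at h1
      linear_combination h1 / 2
    · have hne : e (bar τ σ) ≠ e σ := fun h => hσ (e.injective h)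
      rcases lt_or_gt_of_ne hne with hlt | hlt
      · refine eq_zero_of_apply_single_left hB hn fun z => ?_
        have h1 := key z
        have hc1 : c σ = 0 := if_neg (not_le.2 hlt)
        have hc2 : c (bar τ σ) = 1 := if_pos (by rw [bar_bar]; exact hlt.le)
        rw [hc1, hc2, zero_mul, one_mul] at h1
        exact h1.symm
      · refine eq_zero_of_apply_single_right hB hn fun z => ?_
        have h1 := key z
        have hc1 : c σ = 1 := if_pos hlt.le
        have hc2 : c (bar τ σ) = 0 := if_neg (by rw [bar_bar]; exact not_le.2 hlt)
        rw [hc1, hc2, zero_mul, one_mul] at h1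
        exact h1
  · simp only [LinearMap.sub_apply]
    rw [hB' x y z, hB'.flip x y z]

/-- If an odd multiple of `V_r` is polarized, then the self-conjugate `V_σ` carry alternating
forms. -/
theorem hasForm_neg_one_of_isPolarized {m : ℕ} (hm : Odd m)
    (h : IsPolarized τ (multiple m (Vr E))) {σ : Center E →ₐ[ℚ] ℂ} (hσ : bar τ σ = σ) :
    HasForm τ σ (-1) := by
  refine (hasForm_one_or_neg_one τ hσ).resolve_left ?_
  rintro ⟨B, hn, hB, hsymm⟩
  obtain ⟨B', halt, hn', hB'⟩ := isPolarized_iff.1 h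
  have hsimple := isSimple_simpleRep σ
  have := hsimple.1
  let f (σ' : Center E →ₐ[ℚ] ℂ) (i : Fin m) : SimpleSpace σ' →ₗ[ℂ] (Fin m → VrSpace E) :=
    LinearMap.single ℂ (fun _ => VrSpace E) i ∘ₗ
      LinearMap.single ℂ (fun σ : Center E →ₐ[ℚ] ℂ => SimpleSpace σ) σ'
  have hf (σ') (i : Fin m) (x : E) (y) :
      f σ' i (simpleRep σ' x y) = multiple m (Vr E) x (f σ' i y) := by
    change Pi.single i _ = _
    rw [vr_single]
    exact (multiple_single m (Vr E) x i _).symm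
  have hc (i j : Fin m) := hsimple.exists_form_eq_smul hn hB (hB'.pullback (hf σ i) (hf σ j))
  choose c hc using hc
  have hc (i j y z) : B' (f σ i y) (f σ j z) = c i j * B y z := hc i j y z
  obtain ⟨y, z, hyz⟩ : ∃ y z, B y z ≠ 0 := by
    by_contra! h
    obtain ⟨y, hy⟩ := exists_ne (0 : SimpleSpace σ)
    exact hy (hn.1 y (h y))
  -- On the `m` copies of `V_σ` the form is `M ⊗ B` with `B` symmetric, so `M` is skew. For odd `m`
  -- its determinant vanishes, and a left kernel vector `u` gives a nonzero vector in the radical of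
  -- `B'`.
  let M : Matrix (Fin m) (Fin m) ℂ := Matrix.of c
  have hM : M.transpose = -M := by
    ext i j
    have h1 := halt.neg_eq (f σ i y) (f σ j z)
    rw [hc, hc, hsymm y z, one_mul] at h1
    have h2 : c j i = -c i j := mul_right_cancel₀ hyz (by rw [neg_mul]; exact h1.symm)
    exact h2
  have hdet : M.det = 0 := by
    have h1 := congrArg Matrix.det hM
    rw [Matrix.det_transpose, Matrix.det_neg, Fintype.card_fin, hm.neg_one_pow] at h1
    linear_combination h1 / 2
  obtain ⟨u, hu0, hu⟩ := Matrix.exists_vecMul_eq_zero_iff.2 hdet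
  have hy0 : y ≠ 0 := fun h => hyz (by rw [h, map_zero, LinearMap.zero_apply])
  refine hu0 (funext fun i => ?_)
  have hY : ∑ i, u i • f σ i y = 0 := by
    refine hn'.1 _ fun z => ?_
    have hz : B' (∑ i, u i • f σ i y) = 0 := by
      refine LinearMap.pi_ext' fun j => LinearMap.pi_ext' fun σ' => LinearMap.ext fun z => ?_
      change B' (∑ i, u i • f σ i y) (f σ' j z) = 0
      rw [map_sum, LinearMap.sum_apply]
      by_cases hs : σ' = σ
      · subst hs
        have h2 := congrFun hu j
        simp only [Matrix.vecMul, dotProduct, M, Matrix.of_apply, Pi.zero_apply] at h2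
        simp only [map_smul, LinearMap.smul_apply, hc, smul_eq_mul]
        simp_rw [← mul_assoc]
        rw [← Finset.sum_mul, h2, zero_mul]
      · refine Finset.sum_eq_zero fun i _ => ?_
        rw [map_smul, LinearMap.smul_apply, hB'.apply_eq_zero (σ := σ) (σ' := σ')
          (fun h' => hs (by rw [← bar_bar τ σ', ← h', hσ]))
          (map_mem_isotypicPart (hf σ i) y) (map_mem_isotypicPart (hf σ' j) z), smul_zero]
    rw [hz, LinearMap.zero_apply]
  have h3 := congrFun (congrFun hY i) σ
  rw [Finset.sum_apply, Finset.sum_apply, Finset.sum_eq_single i] at h3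
  · simp only [f, Pi.smul_apply, LinearMap.comp_apply, LinearMap.single_apply, Pi.single_eq_same,
      Pi.zero_apply] at h3
    exact (smul_eq_zero.1 h3).resolve_right hy0
  · intro j _ hj
    simp [f, Pi.single_eq_of_ne hj.symm]
  · simp

theorem isPolarized_vr_of_odd {m : ℕ} (hm : Odd m) (h : IsPolarized τ (multiple m (Vr E))) :
    IsPolarized τ (Vr E) :=
  isPolarized_vr τ fun _ hσ => hasForm_neg_one_of_isPolarized τ hm h hσ

end Dichotomy

end RatRep

namespace RatRep

/-! ### Positivity -/

section Positivity

/-- A real quadratic form that is nonnegative on rational vectors is nonnegative. -/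
theorem sum_mul_mul_nonneg_of_rat {ι : Type*} [Fintype ι] (M : ι → ι → ℝ)
    (h : ∀ q : ι → ℚ, 0 ≤ ∑ i, ∑ j, (q i : ℝ) * q j * M i j) (a : ι → ℝ) :
    0 ≤ ∑ i, ∑ j, a i * a j * M i j := by
  have hd : DenseRange fun q : ι → ℚ => fun i => (q i : ℝ) :=
    DenseRange.piMap fun _ => Rat.isDenseEmbedding_coe_real.dense
  refine hd.induction_on (p := fun a : ι → ℝ => 0 ≤ ∑ i, ∑ j, a i * a j * M i j) a ?_ h
  exact isClosed_le continuous_const (by fun_prop)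

variable {E : Type u} [Ring E] [Algebra ℚ E] [FiniteDimensional ℚ E] [IsSimpleRing E]
  (τ : PositiveInvolution E)

/-- The Hermitian trace form of `V_r` is nonnegative. -/
theorem re_sum_trace_nonneg {ι : Type*} [Fintype ι] (x : ι → E) (c : ι → ℂ) :
    0 ≤ (∑ i, ∑ j, c i * conj (c j) *
      LinearMap.trace ℂ _ (Vr E (x i * τ.toLin (x j)))).re := by
  obtain ⟨k, hk0, hk⟩ := exists_trace_eq_trace_vr E
  let t : E →ₗ[ℚ] ℚ := (LinearMap.trace ℚ E) ∘ₗ (Algebra.lmul ℚ E).toLinearMap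
  have ht (y : E) : LinearMap.trace ℂ _ (Vr E y) = ((t y / k : ℝ) : ℂ) := by
    have h1 : ((t y : ℚ) : ℂ) = k * LinearMap.trace ℂ _ (Vr E y) := hk y
    push_cast
    rw [h1, mul_div_cancel_left₀ _ (Nat.cast_ne_zero.2 hk0)]
  have hpos (y : E) : 0 ≤ t (y * τ.toLin y) := by
    by_cases hy : y = 0
    · simp [hy]
    · exact (τ.pos y hy).le
  have hM := sum_mul_mul_nonneg_of_rat (fun i j => (t (x i * τ.toLin (x j)) / k : ℝ)) fun q => by
    have h1 := hpos (∑ i, q i • x i)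
    have h2 : t ((∑ i, q i • x i) * τ.toLin (∑ i, q i • x i)) =
        ∑ i, ∑ j, q i * q j * t (x i * τ.toLin (x j)) := by
      simp only [map_sum, map_smul, Finset.sum_mul_sum, smul_mul_smul_comm, smul_eq_mul]
    rw [h2] at h1
    have h3 : ∑ i, ∑ j, (q i : ℝ) * q j * (t (x i * τ.toLin (x j)) / k) =
        ((∑ i, ∑ j, q i * q j * t (x i * τ.toLin (x j)) : ℚ) : ℝ) / k := by
      push_cast
      rw [Finset.sum_div]
      refine Finset.sum_congr rfl fun i _ => ?_
      rw [Finset.sum_div]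
      exact Finset.sum_congr rfl fun j _ => by rw [mul_div_assoc]
    rw [h3]
    exact div_nonneg (by exact_mod_cast h1) (Nat.cast_nonneg k)
  -- The traces are real, so the real part splits into the real quadratic form evaluated at the real
  -- and at the imaginary parts of `c`.
  have h : (∑ i, ∑ j, c i * conj (c j) *
      LinearMap.trace ℂ _ (Vr E (x i * τ.toLin (x j)))).re =
      (∑ i, ∑ j, (c i).re * (c j).re * (t (x i * τ.toLin (x j)) / k : ℝ)) +
      ∑ i, ∑ j, (c i).im * (c j).im * (t (x i * τ.toLin (x j)) / k : ℝ) := by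
    rw [Complex.re_sum, ← Finset.sum_add_distrib]
    refine Finset.sum_congr rfl fun i _ => ?_
    rw [Complex.re_sum, ← Finset.sum_add_distrib]
    refine Finset.sum_congr rfl fun j _ => ?_
    rw [ht, Complex.re_mul_ofReal, Complex.mul_re, Complex.conj_re, Complex.conj_im]
    ring
  rw [h]
  exact add_nonneg (hM _) (hM _)

/-- The endomorphisms of a single `V_σ` are in the complex span of `E`. -/
theorem single_comp_proj_mem_span {σ : Center E →ₐ[ℚ] ℂ} (t : Module.End ℂ (SimpleSpace σ)) :
    (LinearMap.single ℂ (fun σ : Center E →ₐ[ℚ] ℂ => SimpleSpace σ) σ ∘ₗ t ∘ₗ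
      LinearMap.proj σ : Module.End ℂ (VrSpace E)) ∈ Submodule.span ℂ (Set.range (Vr E)) := by
  obtain ⟨e, h1, h2, h3⟩ := exists_center_idempotents (Vr E)
  have he : e σ ∈ Submodule.span ℂ (Set.range (Vr E)) := by
    refine Submodule.span_mono ?_ (h3 σ)
    rintro _ ⟨z, rfl⟩
    exact ⟨z, rfl⟩
  have hes (y : VrSpace E) : e σ y = Pi.single σ (y σ) := by
    have hi (σ') := idempotent_apply (Vr E) h1 h2 h3 (map_mem_isotypicPart (vr_single σ') (y σ'))
    simp only [LinearMap.single_apply] at hi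
    conv_lhs => rw [← Finset.univ_sum_single y, map_sum]
    rw [Finset.sum_eq_single σ (fun σ' _ h => (hi σ').2 σ h.symm) (by simp)]
    exact (hi σ).1
  have ht : t ∈ Submodule.span ℂ (Set.range (simpleRep σ)) := by
    rw [(isSimple_simpleRep σ).span_range_eq_top]; trivial
  induction ht using Submodule.span_induction with
  | mem t ht =>
    -- The idempotent `e σ` is the projection onto the `σ`-block, so the block of `x` is `Vr E x * e
    -- σ`.
    obtain ⟨x, rfl⟩ := ht
    convert mem_span_range_mul (Vr E) (Submodule.subset_span ⟨x, rfl⟩) he using 1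
    refine LinearMap.ext fun y => ?_
    rw [Module.End.mul_apply, hes]
    exact vr_single σ x (y σ)
  | zero => simp
  | add f g _ _ hf hg =>
    rw [LinearMap.add_comp, LinearMap.comp_add]
    exact Submodule.add_mem _ hf hg
  | smul c f _ hf =>
    rw [LinearMap.smul_comp, LinearMap.comp_smul]
    exact Submodule.smul_mem _ c hf

/-- An endomorphism of `V_σ` and its adjoint for an invariant sesquilinear form: the trace of
their product has nonnegative real part. -/
theorem exists_adjoint {σ : Center E →ₐ[ℚ] ℂ} (t : Module.End ℂ (SimpleSpace σ)) :
    ∃ t' : Module.End ℂ (SimpleSpace σ), 0 ≤ (LinearMap.trace ℂ _ (t * t')).re ∧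
      ∀ H : SimpleSpace σ →ₛₗ[starRingEnd ℂ] SimpleSpace σ →ₗ[ℂ] ℂ,
        (∀ x y z, H (simpleRep σ x y) z = H y (simpleRep σ (τ.toLin x) z)) →
        ∀ y z, H (t y) z = H y (t' z) := by
  -- Extending `t` by zero to `V_r` gives a combination `∑ c_x x`, whose adjoint is `∑ conj(c_x)
  -- x*`. The other blocks of the extension vanish, so the trace of the product on `V_r` only sees
  -- the `σ`-block.
  obtain ⟨c, hc⟩ := Finsupp.mem_span_range_iff_exists_finsupp.1 (single_comp_proj_mem_span t)
  let T' : Module.End ℂ (VrSpace E) :=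
    ∑ x ∈ c.support, conj (c x) • Vr E (τ.toLin x)
  let t' : Module.End ℂ (SimpleSpace σ) :=
    ∑ x ∈ c.support, conj (c x) • simpleRep σ (τ.toLin x)
  rw [Finsupp.sum] at hc
  have ht : t = ∑ x ∈ c.support, c x • simpleRep σ x := by
    refine LinearMap.ext fun y => ?_
    have := congrFun (LinearMap.congr_fun hc (Pi.single σ y)) σ
    simp only [LinearMap.comp_apply, LinearMap.proj_apply, LinearMap.single_apply,
      Pi.single_eq_same, LinearMap.sum_apply, LinearMap.smul_apply, Finset.sum_apply,
      Pi.smul_apply] at this ⊢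
    rw [← this]
    refine Finset.sum_congr rfl fun x _ => ?_
    rw [Vr, directSum_apply, Pi.single_eq_same]
  have hT' : LinearMap.proj σ ∘ₗ T' ∘ₗ
      LinearMap.single ℂ (fun σ : Center E →ₐ[ℚ] ℂ => SimpleSpace σ) σ = t' := by
    refine LinearMap.ext fun y => ?_
    simp only [T', t', LinearMap.comp_apply, LinearMap.proj_apply, LinearMap.single_apply,
      LinearMap.sum_apply, LinearMap.smul_apply, Finset.sum_apply, Pi.smul_apply]
    refine Finset.sum_congr rfl fun x _ => ?_
    rw [Vr, directSum_apply, Pi.single_eq_same]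
  refine ⟨t', ?_, fun H hH y z => ?_⟩
  · have h1 := re_sum_trace_nonneg τ (fun x : c.support => (x : E)) (fun x => c x)
    have h2 : LinearMap.trace ℂ _ (t * t') =
        LinearMap.trace ℂ _ ((∑ x ∈ c.support, c x • Vr E x) * T') := by
      rw [hc, ← hT']
      exact (LinearMap.trace_comp_comm' (t ∘ₗ LinearMap.proj σ ∘ₗ T')
        (LinearMap.single ℂ (fun σ : Center E →ₐ[ℚ] ℂ => SimpleSpace σ) σ)).symm
    rw [h2]
    convert h1 using 2
    simp only [T', Finset.sum_mul_sum, smul_mul_smul_comm, ← map_mul, map_sum, map_smul,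
      smul_eq_mul]
    rw [← Finset.sum_coe_sort]
    refine Finset.sum_congr rfl fun x _ => ?_
    rw [← Finset.sum_coe_sort]
  · simp only [ht, t', LinearMap.sum_apply, LinearMap.smul_apply, map_sum, map_smul,
      LinearMap.map_smulₛₗ, smul_eq_mul, hH]

/-! ### Antilinear structures -/

/-- The sign of the square of an antilinear structure on `V_σ` is the sign of its invariant
form. -/
theorem not_hasForm_neg {σ : Center E →ₐ[ℚ] ℂ} {δ : ℂ} (hδ : δ = 1 ∨ δ = -1)
    (J : SimpleSpace σ →ₛₗ[starRingEnd ℂ] SimpleSpace σ)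
    (hJ : ∀ x y, J (simpleRep σ x y) = simpleRep σ x (J y)) (hJJ : ∀ y, J (J y) = δ • y) :
    ¬ HasForm τ σ (-δ) := by
  rintro ⟨B, hn, hB, hε⟩
  have hsimple := isSimple_simpleRep σ
  have := hsimple.1
  have hδδ : δ * δ = 1 := by rcases hδ with rfl | rfl <;> norm_num
  have hcδ : conj δ = δ := by rcases hδ with rfl | rfl <;> simp
  have hJJ' (y) : J (δ • J y) = y := by
    rw [J.map_smulₛₗ, hcδ, hJJ, smul_smul, hδδ, one_smul]
  -- Twisting `B` by `J` yields another invariant form, so it is `l * B`, and `J² = δ` forces `|l| =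
  -- 1`.
  let B' : LinearMap.BilinForm ℂ (SimpleSpace σ) :=
    LinearMap.mk₂ ℂ (fun y z => conj (B (J y) (J z)))
      (fun _ _ _ => by simp) (fun _ _ _ => by simp) (fun _ _ _ => by simp) (fun _ _ _ => by simp)
  obtain ⟨l, hl⟩ := hsimple.exists_form_eq_smul hn hB (B' := B') fun x y z => by
    simp only [B', LinearMap.mk₂_apply, hJ, hB _ _ (J z)]
  have hl (y z) : conj (B (J y) (J z)) = l * B y z := hl y z
  obtain ⟨y₀, z₀, h0⟩ : ∃ y z, B y z ≠ 0 := by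
    by_contra! h
    obtain ⟨y, hy⟩ := exists_ne (0 : SimpleSpace σ)
    exact hy (hn.1 y (h y))
  have hll : l * conj l = 1 := by
    have h1 := hl (J y₀) (J z₀)
    have h2 : B (J y₀) (J z₀) = conj l * conj (B y₀ z₀) := by
      rw [← map_mul, ← hl, Complex.conj_conj]
    rw [h2, hJJ, hJJ] at h1
    simp only [map_smul, LinearMap.smul_apply, smul_eq_mul, map_mul, hcδ] at h1
    have h3 : conj (B y₀ z₀) ≠ 0 := (map_ne_zero _).2 h0
    refine mul_right_cancel₀ h3 ?_
    linear_combination conj (B y₀ z₀) * hδδ - h1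
  -- With `ν² = -l` and `|ν| = 1`, the sesquilinear form `ν B(J y, z)` becomes Hermitian.
  obtain ⟨ν, hν⟩ := IsAlgClosed.exists_pow_nat_eq (-l) two_pos
  have hνν : conj ν * ν = 1 := by
    have h1 : ((Complex.normSq ν : ℝ) : ℂ) ^ 2 = 1 := by
      rw [← Complex.mul_conj, mul_pow, ← map_pow, hν, map_neg, neg_mul_neg, hll]
    have h2 : Complex.normSq ν ^ 2 = 1 := by exact_mod_cast h1
    have h3 : Complex.normSq ν = 1 :=
      (pow_eq_one_iff_of_nonneg (Complex.normSq_nonneg ν) two_ne_zero).1 h2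
    rw [mul_comm, Complex.mul_conj, h3, Complex.ofReal_one]
  have hνl : conj ν * l = -ν := by
    linear_combination conj ν * hν - ν * hνν
  obtain ⟨H, hH⟩ : ∃ H : SimpleSpace σ →ₛₗ[starRingEnd ℂ] SimpleSpace σ →ₗ[ℂ] ℂ,
      ∀ y z, H y z = ν * B (J y) z := ⟨ν • LinearMap.comp B J, fun _ _ => rfl⟩
  have hherm (y z) : conj (H z y) = H y z := by
    have h1 : y = J (δ • J y) := (hJJ' y).symm
    rw [hH, hH]
    conv_lhs => rw [h1]
    rw [map_mul, hl, map_smul, hε (J y) z, smul_eq_mul]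
    linear_combination (-(δ * δ) * B (J y) z) * hνl + ν * B (J y) z * hδδ
  -- The sign `-δ` of `B` against `J² = δ` makes `J` reverse the sign of `H`, which will contradict
  -- positivity.
  have hHJ (y) : H (J y) (J y) = - H y y := by
    rw [hH, hH, hJJ, map_smul, LinearMap.smul_apply, hε (J y) y, smul_eq_mul]
    linear_combination (-ν * B (J y) y) * hδδ
  have hinv (x y z) : H (simpleRep σ x y) z = H y (simpleRep σ (τ.toLin x) z) := by
    rw [hH, hH, hJ, hB]
  have hnr (z) (h : ∀ y, H y z = 0) : z = 0 := by
    refine hn.2 z fun y => ?_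
    have h1 := h (δ • J y)
    have hν0 : ν ≠ 0 := fun h => by rw [h, mul_zero] at hνν; exact zero_ne_one hνν
    rw [hH, hJJ'] at h1
    exact (mul_eq_zero.1 h1).resolve_left hν0
  -- The rank-one map `z ↦ H(v, z) J v` has adjoint `z ↦ H(J v, z) v`. The trace of their product is
  -- `H(v, v) H(J v, J v) = -H(v, v)²`, which must be nonnegative.
  have hdiag (v) : H v v = 0 := by
    obtain ⟨t', ht1, ht2⟩ := exists_adjoint τ ((H v).smulRight (J v))
    have ht' (z) : t' z = H (J v) z • v := by
      rw [← sub_eq_zero]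
      refine hnr _ fun y => ?_
      rw [map_sub, ← ht2 H hinv, LinearMap.smulRight_apply, LinearMap.map_smulₛₗ,
        LinearMap.smul_apply, hherm, map_smul, smul_eq_mul, smul_eq_mul, mul_comm, sub_self]
    have htr : LinearMap.trace ℂ _ ((H v).smulRight (J v) * t') = -(H v v) ^ 2 := by
      have : (H v).smulRight (J v) * t' = (H v v • H (J v)).smulRight (J v) := by
        refine LinearMap.ext fun z => ?_
        rw [Module.End.mul_apply, ht', LinearMap.smulRight_apply, LinearMap.smulRight_apply,
          map_smul, LinearMap.smul_apply, smul_eq_mul, smul_eq_mul, mul_comm]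
      rw [this, LinearMap.trace_smulRight, LinearMap.smul_apply, hHJ, smul_eq_mul]
      ring
    have him : (H v v).im = 0 := Complex.conj_eq_iff_im.1 (hherm v v)
    rw [htr, Complex.neg_re, sq, Complex.mul_re, him] at ht1
    refine Complex.ext ?_ him
    have : (H v v).re * (H v v).re = 0 := by nlinarith [mul_self_nonneg (H v v).re]
    exact mul_self_eq_zero.1 this
  -- Polarization identity, using `v + w` and `v + i w`.
  have hzero (v w) : H v w = 0 := by
    have h1 := hdiag (v + w)
    have h2 := hdiag (v + Complex.I • w)
    simp only [map_add, LinearMap.add_apply, hdiag, map_smul, LinearMap.map_smulₛₗ,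
      LinearMap.smul_apply, smul_eq_mul, Complex.conj_I] at h1 h2
    have h3 : Complex.I * (2 * H v w) = 0 := by linear_combination h2 + Complex.I * h1
    simpa [Complex.I_ne_zero] using h3
  obtain ⟨z, hz⟩ := exists_ne (0 : SimpleSpace σ)
  exact hz (hnr z fun y => hzero y z)

end Positivity

end RatRep

namespace RatRep

/-! ### The center of a matrix algebra -/

section MatrixCenter

variable {E : Type u} [Ring E] [Algebra ℚ E] [IsSimpleRing E]
  {D : Type w} [DivisionRing D] [Algebra ℚ D] {n : ℕ}

theorem size_pos (e : E ≃ₐ[ℚ] Matrix (Fin n) (Fin n) D) : 0 < n := by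
  rcases Nat.eq_zero_or_pos n with rfl | h
  · have := e.toEquiv.subsingleton
    exact (not_subsingleton E this).elim
  · exact h

/-- The center of `D` is the center of the algebra of matrices over `D`. -/
def centerEquiv (e : E ≃ₐ[ℚ] Matrix (Fin n) (Fin n) D) :
    Subring.center D ≃+* Center E :=
  RingEquiv.ofBijective
    ({ toFun := fun z => ⟨e.symm (Matrix.scalar (Fin n) (z : D)), by
        refine Subalgebra.mem_center_iff.2 fun x => e.injective ?_
        rw [map_mul, map_mul, e.apply_symm_apply]
        exact ((Matrix.scalar_commute (z : D) (fun r => (Subring.mem_center_iff.1 z.2 r).symm)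
          (e x)).eq).symm⟩
       map_one' := Subtype.ext (by simp)
       map_mul' := fun a b => Subtype.ext (by simp only [Subring.coe_mul, map_mul]; rfl)
       map_zero' := Subtype.ext (by simp)
       map_add' := fun a b => Subtype.ext (by simp [← Matrix.diagonal_add]) } :
        Subring.center D →+* Center E)
    (by
      have : Nonempty (Fin n) := ⟨⟨0, size_pos e⟩⟩
      refine ⟨fun a b h => ?_, fun x => ?_⟩
      · have h1 := congrArg Subtype.val h
        exact Subtype.ext (Matrix.scalar_inj.1 (e.symm.injective h1))
      · have h1 : e x ∈ Set.center (Matrix (Fin n) (Fin n) D) := by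
          refine Semigroup.mem_center_iff.2 fun M => ?_
          have h2 := congrArg e (Subalgebra.mem_center_iff.1 x.2 (e.symm M))
          rwa [map_mul, map_mul, e.apply_symm_apply] at h2
        rw [Matrix.center_eq_scalar_image] at h1
        obtain ⟨z, hz, hzx⟩ := h1
        exact ⟨⟨z, hz⟩, Subtype.ext (e.injective ((e.apply_symm_apply _).trans hzx))⟩)

theorem apply_centerEquiv (e : E ≃ₐ[ℚ] Matrix (Fin n) (Fin n) D)
    (z : Subring.center D) :
    e (centerEquiv e z) = Matrix.scalar (Fin n) (z : D) := e.apply_symm_apply _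

theorem finrank_center_eq (e : E ≃ₐ[ℚ] Matrix (Fin n) (Fin n) D) :
    Module.finrank (Center E) E =
    n ^ 2 * Module.finrank (Subring.center D) D := by
  have h1 := Algebra.finrank_eq_of_equiv_equiv (R₀ := Subring.center D)
    (S₀ := Matrix (Fin n) (Fin n) D) (R₁ := Center E) (S₁ := E) (centerEquiv e)
    e.symm.toRingEquiv (RingHom.ext fun z => e.injective (by
      change e (centerEquiv e z) = e (e.symm (algebraMap _ _ z))
      rw [apply_centerEquiv, e.apply_symm_apply]
      rfl))
  rw [← h1, Module.finrank_matrix, Fintype.card_fin, sq]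

/-- The embedding of the center of `D` induced by one of the center of `E`. -/
def centerEmbedding (e : E ≃ₐ[ℚ] Matrix (Fin n) (Fin n) D)
    (σ : Center E →ₐ[ℚ] ℂ) : Subring.center D →+* ℂ :=
  (σ : Center E →+* ℂ).comp (centerEquiv e : Subring.center D →+* Center E)

theorem conj_embedding_eq (e : E ≃ₐ[ℚ] Matrix (Fin n) (Fin n) D)
    (h : NumberField.IsTotallyReal (Subring.center D))
    (σ : Center E →ₐ[ℚ] ℂ) (z : Center E) : conj (σ z) = σ z := by
  obtain ⟨z, rfl⟩ := (centerEquiv e).surjective z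
  exact RingHom.congr_fun (h.complexEmbedding_isReal (centerEmbedding e σ)) z

variable [FiniteDimensional ℚ E]

theorem exists_degree (e : E ≃ₐ[ℚ] Matrix (Fin n) (Fin n) D) :
    ∃ d : ℕ, d ^ 2 = Module.finrank (Subring.center D) D ∧
    Module.finrank ℂ (VrSpace E) = n * d * Module.finrank ℚ (Center E) := by
  obtain ⟨σ⟩ : Nonempty (Center E →ₐ[ℚ] ℂ) := inferInstance
  have h := finrank_simpleSpace_sq σ
  rw [finrank_center_eq e] at h
  -- From `(dim V_σ)² = n² [D : F]`, `n` divides `dim V_σ`, and `d` is the quotient.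
  obtain ⟨d, hd⟩ := (Nat.pow_dvd_pow_iff two_ne_zero).1 (Dvd.intro _ h.symm)
  refine ⟨d, ?_, ?_⟩
  · rw [hd, mul_pow] at h
    exact Nat.eq_of_mul_eq_mul_left (pow_pos (size_pos e) 2) h
  · rw [finrank_vrSpace E σ, hd, mul_comm]

/-- An antilinear structure on a representation of `D` gives one on `V_σ`. -/
theorem not_hasForm_neg_of_rep (e : E ≃ₐ[ℚ] Matrix (Fin n) (Fin n) D)
    (τ : PositiveInvolution E) {σ : Center E →ₐ[ℚ] ℂ}
    {U : Type*} [AddCommGroup U] [Module ℂ U] [FiniteDimensional ℂ U] (r : D →+* Module.End ℂ U)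
    (hr : ∀ z : Subring.center D, r z = centerEmbedding e σ z • 1)
    (hU : Module.finrank ℂ U ^ 2 = Module.finrank (Subring.center D) D)
    (J : U →ₛₗ[starRingEnd ℂ] U) (hJ : ∀ x y, J (r x y) = r x (J y))
    {δ : ℂ} (hδ : δ = 1 ∨ δ = -1) (hJJ : ∀ y, J (J y) = δ • y) : ¬ HasForm τ σ (-δ) := by
  -- Matrices over `D` act on column vectors `U ^ n`. The center acts through `σ` and the dimension
  -- is that of `V_σ`, so this is `V_σ`, and `J` acts componentwise.
  let ρ : E →+* Module.End ℂ (Fin n → U) :=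
    ((endVecRingEquivMatrixEnd (Fin n) ℂ U).symm : Matrix (Fin n) (Fin n) (Module.End ℂ U) →+*
      Module.End ℂ (Fin n → U)).comp
      ((RingHom.mapMatrix r).comp (e : E →+* Matrix (Fin n) (Fin n) D))
  have hρ (x : E) (y : Fin n → U) (i : Fin n) : ρ x y i = ∑ j, r (e x i j) (y j) := rfl
  have hcenter (z : Center E) : ρ z = σ z • 1 := by
    obtain ⟨z, rfl⟩ := (centerEquiv e).surjective z
    refine LinearMap.ext fun y => funext fun i => ?_
    rw [hρ, apply_centerEquiv, Finset.sum_eq_single i]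
    · rw [Matrix.scalar_apply, Matrix.diagonal_apply_eq, hr]
      rfl
    · intro j _ hj
      rw [Matrix.scalar_apply, Matrix.diagonal_apply_ne _ hj.symm, map_zero, LinearMap.zero_apply]
    · simp
  have hdim : Module.finrank ℂ (Fin n → U) ^ 2 = Module.finrank (Center E) E := by
    rw [finrank_multiple, mul_pow, hU, finrank_center_eq e]
  obtain ⟨φ, hφ⟩ := iso_simpleRep_of_finrank_eq ρ hcenter hdim
  have hφ' (x y) : φ.symm (simpleRep σ x y) = ρ x (φ.symm y) := by
    rw [LinearEquiv.symm_apply_eq, hφ, φ.apply_symm_apply]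
  let J' : (Fin n → U) →ₛₗ[starRingEnd ℂ] (Fin n → U) :=
    { toFun := fun y i => J (y i)
      map_add' := fun y z => funext fun i => J.map_add _ _
      map_smul' := fun c y => funext fun i => J.map_smulₛₗ c _ }
  have hJ' (y i) : J' y i = J (y i) := rfl
  refine not_hasForm_neg τ hδ ((φ : (Fin n → U) →ₗ[ℂ] SimpleSpace σ).comp
    (J'.comp (φ.symm : SimpleSpace σ →ₗ[ℂ] (Fin n → U)))) (fun x y => ?_) (fun y => ?_)
  · simp only [LinearMap.comp_apply, LinearEquiv.coe_coe]
    rw [hφ', ← hφ]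
    congr 1
    funext i
    rw [hρ, hJ', hρ, map_sum]
    exact Finset.sum_congr rfl fun j _ => hJ _ _
  · simp only [LinearMap.comp_apply, LinearEquiv.coe_coe]
    rw [φ.symm_apply_apply]
    have : J' (J' (φ.symm y)) = δ • φ.symm y := funext fun i => hJJ _
    rw [this, map_smul, φ.apply_symm_apply]

end MatrixCenter

/-! ### The involution on the center -/

theorem embedding_injective {E : Type u} [Ring E] [Algebra ℚ E] [IsSimpleRing E]
    (σ : Center E →ₐ[ℚ] ℂ) : Function.Injective σ := by
  refine (injective_iff_map_eq_zero σ).2 fun z hz => ?_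
  by_contra hne
  obtain ⟨y, hy⟩ := (isField_center E).mul_inv_cancel hne
  have := congrArg σ hy
  rw [map_mul, hz, zero_mul, map_one] at this
  exact zero_ne_one this

section CenterInvolution

variable {E : Type u} [Ring E] [Algebra ℚ E] [FiniteDimensional ℚ E] [IsSimpleRing E]
  (τ : PositiveInvolution E)

/-- Positivity at a central `z`: up to a positive factor, the trace of `z z*` on `E` is this sum. -/
theorem re_sum_embeddings_pos {z : Center E} (hz : z ≠ 0) :
    0 < (∑ σ : Center E →ₐ[ℚ] ℂ, σ z * bar τ σ z).re := by
  obtain ⟨k, hk0, hk⟩ := exists_trace_eq_trace_vr E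
  obtain ⟨σ₀⟩ : Nonempty (Center E →ₐ[ℚ] ℂ) := inferInstance
  have h1 := τ.pos z fun h => hz (Subtype.ext h)
  have h2 := hk (z * τ.toLin z)
  have h3 : LinearMap.trace ℂ _ (Vr E (z * τ.toLin z)) =
      Module.finrank ℂ (SimpleSpace σ₀) * ∑ σ : Center E →ₐ[ℚ] ℂ, σ z * bar τ σ z := by
    rw [trace_directSum _ (fun σ => simpleRep σ (z * τ.toLin z)) (fun _ _ => rfl), Finset.mul_sum]
    refine Finset.sum_congr rfl fun σ _ => ?_
    have := trace_simpleRep σ (z * centerInvolution τ z)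
    rw [map_mul, finrank_simpleSpace_eq σ σ₀] at this
    exact this
  rw [h3] at h2
  have h4 := congrArg Complex.re h2
  rw [← mul_assoc, ← Nat.cast_mul, ← Complex.ofReal_natCast, Complex.re_ofReal_mul,
    Complex.ratCast_re] at h4
  have h5 : (0 : ℝ) < (LinearMap.trace ℚ E (LinearMap.mulLeft ℚ (z * τ.toLin z)) : ℚ) := by
    exact_mod_cast h1
  rw [h4] at h5
  by_contra h
  exact absurd h5 (not_lt.2 (mul_nonpos_of_nonneg_of_nonpos (Nat.cast_nonneg _) (not_lt.1 h)))

/-- If `F` is totally real, the involution is trivial on `F`. -/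
theorem bar_eq_of_totallyReal (h : ∀ (σ : Center E →ₐ[ℚ] ℂ) z, conj (σ z) = σ z)
    (σ : Center E →ₐ[ℚ] ℂ) : bar τ σ = σ := by
  refine AlgHom.ext fun z => ?_
  by_contra hne
  -- The involution negates `z - z*`. Its images under the embeddings are real, so the sum in the
  -- positivity statement is minus a sum of squares.
  have hz : z - centerInvolution τ z ≠ 0 := fun h0 => hne (by
    rw [bar_apply, ← sub_eq_zero.1 h0])
  have h1 := re_sum_embeddings_pos τ hz
  refine absurd h1 (not_lt.2 ?_)
  rw [Complex.re_sum]
  refine Finset.sum_nonpos fun σ _ => ?_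
  have h2 : bar τ σ (z - centerInvolution τ z) = -σ (z - centerInvolution τ z) := by
    rw [bar_apply, map_sub (centerInvolution τ), centerInvolution_centerInvolution, ← map_neg,
      neg_sub]
  have h3 := Complex.conj_eq_iff_im.1 (h σ (z - centerInvolution τ z))
  rw [h2, mul_neg, Complex.neg_re, Complex.mul_re, h3]
  nlinarith [mul_self_nonneg (σ (z - centerInvolution τ z)).re]

/-- If some nonzero element of `F` is imaginary under all embeddings, the involution is not
trivial on `F`. -/
theorem bar_ne_of_imaginary {z : Center E} (hz : z ≠ 0)
    (h : ∀ σ : Center E →ₐ[ℚ] ℂ, conj (σ z) = -σ z) (σ : Center E →ₐ[ℚ] ℂ) : bar τ σ ≠ σ := by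
  intro hσ
  -- Self-conjugacy of a single embedding already makes the involution fix `z`, so the sum becomes
  -- one of squares of imaginary numbers.
  have hid : centerInvolution τ z = z := by
    exact embedding_injective σ (AlgHom.congr_fun hσ z)
  refine absurd (re_sum_embeddings_pos τ hz) (not_lt.2 ?_)
  rw [Complex.re_sum]
  refine Finset.sum_nonpos fun σ _ => ?_
  have h2 := congrArg Complex.re (h σ)
  rw [Complex.conj_re, Complex.neg_re] at h2
  have h3 : (σ z).re = 0 := by linarith
  rw [bar_apply, hid, Complex.mul_re, h3]
  nlinarith [mul_self_nonneg (σ z).im]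

end CenterInvolution

/-! ### The four types -/

section Types

variable {E : Type u} [Ring E] [Algebra ℚ E] [FiniteDimensional ℚ E] [IsSimpleRing E]
  {D : Type w} [DivisionRing D] [Algebra ℚ D] {n : ℕ}

/-- Here `D = F` acts on `ℂ` by real scalars, and complex conjugation is an equivariant `J` with `J²
= 1`. -/
theorem not_hasForm_of_isTypeI (e : E ≃ₐ[ℚ] Matrix (Fin n) (Fin n) D) (τ : PositiveInvolution E)
    (h : IsTypeI D) (σ : Center E →ₐ[ℚ] ℂ) : ¬ HasForm τ σ (-1) := by
  obtain ⟨hcomm, hreal⟩ := h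
  let i : D →+* Subring.center D := (RingHom.id D).codRestrict (Subring.center D)
    fun x => Subring.mem_center_iff.2 fun y => hcomm y x
  let s := centerEmbedding e σ
  have hs (z) : conj (s z) = s z := RingHom.congr_fun (hreal.complexEmbedding_isReal s) z
  let J : ℂ →ₛₗ[starRingEnd ℂ] ℂ :=
    { toFun := conj, map_add' := map_add _, map_smul' := fun c y => map_mul _ c y }
  refine not_hasForm_neg_of_rep e τ (U := ℂ) ((algebraMap ℂ (Module.End ℂ ℂ)).comp (s.comp i))
    (fun z => ?_) ?_ J (fun x y => ?_) (Or.inl rfl) (fun y => ?_)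
  · have : i z = z := Subtype.ext rfl
    rw [RingHom.comp_apply, RingHom.comp_apply, this, Algebra.algebraMap_eq_smul_one]
  · have : Function.Bijective (Algebra.linearMap (Subring.center D) D) :=
      ⟨Subtype.val_injective, fun x => ⟨i x, rfl⟩⟩
    rw [← (LinearEquiv.ofBijective _ this).finrank_eq, Module.finrank_self, Module.finrank_self,
      one_pow]
  · change conj (s (i x) * y) = s (i x) * conj y
    rw [map_mul, hs]
  · change conj (conj y) = (1 : ℂ) • y
    rw [Complex.conj_conj, one_smul]

/-- Common to types II and III: a representation of the real completion on `ℂ²` restricts to `D`,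
and its dimension is right because `2² = [D : F]`. -/
theorem not_hasForm_of_realCompletionIso (e : E ≃ₐ[ℚ] Matrix (Fin n) (Fin n) D) (τ : PositiveInvolution E)
    (hd : Module.finrank (Subring.center D) D = 4)
    (hreal : NumberField.IsTotallyReal (Subring.center D)) {A : Type} [Ring A] [Algebra ℝ A]
    (hA : ∀ s : Subring.center D →+* ℝ, RealCompletionIso D s A)
    (r : A →ₐ[ℝ] Module.End ℂ (Fin 2 → ℂ))
    (J : (Fin 2 → ℂ) →ₛₗ[starRingEnd ℂ] (Fin 2 → ℂ)) (hJ : ∀ a y, J (r a y) = r a (J y))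
    {δ : ℂ} (hδ : δ = 1 ∨ δ = -1) (hJJ : ∀ y, J (J y) = δ • y) (σ : Center E →ₐ[ℚ] ℂ) :
    ¬ HasForm τ σ (-δ) := by
  have hs := hreal.complexEmbedding_isReal (centerEmbedding e σ)
  let s : Subring.center D →+* ℝ := hs.embedding
  let : Algebra (Subring.center D) ℝ := s.toAlgebra
  obtain ⟨f⟩ : Nonempty ((ℝ ⊗[Subring.center D] D) ≃ₐ[ℝ] A) := hA s
  let g : D →+* A := (f : (ℝ ⊗[Subring.center D] D) →+* A).comp
    (Algebra.TensorProduct.includeRight : D →ₐ[Subring.center D] ℝ ⊗[Subring.center D] D).toRingHom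
  have hg (z : Subring.center D) : g z = algebraMap ℝ A (s z) := by
    rw [← f.commutes]
    change f ((1 : ℝ) ⊗ₜ (z : D)) = f (s z ⊗ₜ (1 : D))
    have h1 : (z : D) = z • (1 : D) := by rw [Algebra.smul_def, mul_one]; rfl
    have h2 : s z = z • (1 : ℝ) := by rw [Algebra.smul_def, mul_one]; rfl
    rw [h1, h2, TensorProduct.smul_tmul]
  refine not_hasForm_neg_of_rep e τ ((r : A →+* Module.End ℂ (Fin 2 → ℂ)).comp g)
    (fun z => ?_) ?_ J (fun x y => hJ _ _) hδ hJJ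
  · rw [RingHom.comp_apply, hg]
    refine (r.commutes (s z)).trans ?_
    have : ((s z : ℝ) : ℂ) = centerEmbedding e σ z := hs.coe_embedding_apply z
    rw [← this, Algebra.algebraMap_eq_smul_one]
    rfl
  · rw [hd]; simp

/-- Coordinatewise conjugation on `ℂ²` commutes with real matrices and squares to `1`. -/
theorem not_hasForm_of_isTypeII (e : E ≃ₐ[ℚ] Matrix (Fin n) (Fin n) D) (τ : PositiveInvolution E)
    (h : IsTypeII D) (σ : Center E →ₐ[ℚ] ℂ) :
    ¬ HasForm τ σ (-1) := by
  let r : Matrix (Fin 2) (Fin 2) ℝ →ₐ[ℝ] Module.End ℂ (Fin 2 → ℂ) :=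
    ((Matrix.toLinAlgEquiv' : Matrix (Fin 2) (Fin 2) ℂ ≃ₐ[ℂ] _).toAlgHom.restrictScalars ℝ).comp
      Complex.ofRealAm.mapMatrix
  have hr (a y i) : r a y i = ∑ j, (a i j : ℂ) * y j := rfl
  let J : (Fin 2 → ℂ) →ₛₗ[starRingEnd ℂ] (Fin 2 → ℂ) :=
    { toFun := fun y i => conj (y i)
      map_add' := fun y z => funext fun i => map_add _ _ _
      map_smul' := fun c y => funext fun i => map_mul _ _ _ }
  have hJ (y i) : J y i = conj (y i) := rfl
  refine not_hasForm_of_realCompletionIso e τ h.1 h.2.1 h.2.2 r J (fun a y => funext fun i => ?_)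
    (Or.inl rfl) (fun y => funext fun i => ?_) σ
  · simp [hr, hJ]
  · simp [hJ]

/-- The action of the quaternions on `ℂ²`. -/
def quaternionMatrix : ℍ[ℝ] →ₐ[ℝ] Matrix (Fin 2) (Fin 2) ℂ :=
  AlgHom.ofLinearMap
    { toFun := fun q => !![⟨q.re, q.imI⟩, ⟨q.imJ, q.imK⟩; ⟨-q.imJ, q.imK⟩, ⟨q.re, -q.imI⟩]
      map_add' := fun p q => by
        ext i j
        fin_cases i <;> fin_cases j <;> apply Complex.ext <;> simp <;> ring
      map_smul' := fun c q => by
        ext i j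
        fin_cases i <;> fin_cases j <;> apply Complex.ext <;> simp }
    (by
      ext i j
      fin_cases i <;> fin_cases j <;> apply Complex.ext <;> simp)
    (fun p q => by
      ext i j
      fin_cases i <;> fin_cases j <;> apply Complex.ext <;>
        simp [Matrix.mul_apply, Fin.sum_univ_two] <;> ring)

/-- The quaternionic structure `(y₀, y₁) ↦ (-conj y₁, conj y₀)` commutes with the quaternions and
squares to `-1`, which excludes the symmetric sign. -/
theorem not_hasForm_of_isTypeIII (e : E ≃ₐ[ℚ] Matrix (Fin n) (Fin n) D) (τ : PositiveInvolution E)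
    (h : IsTypeIII D) (σ : Center E →ₐ[ℚ] ℂ) :
    ¬ HasForm τ σ 1 := by
  let r : ℍ[ℝ] →ₐ[ℝ] Module.End ℂ (Fin 2 → ℂ) :=
    ((Matrix.toLinAlgEquiv' : Matrix (Fin 2) (Fin 2) ℂ ≃ₐ[ℂ] _).toAlgHom.restrictScalars ℝ).comp
      quaternionMatrix
  have hr (a y i) : r a y i = ∑ j, quaternionMatrix a i j * y j := rfl
  let J : (Fin 2 → ℂ) →ₛₗ[starRingEnd ℂ] (Fin 2 → ℂ) :=
    { toFun := fun y => ![-conj (y 1), conj (y 0)]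
      map_add' := fun y z => by
        ext i
        fin_cases i <;> simp
        ring
      map_smul' := fun c y => by
        ext i
        fin_cases i <;> simp }
  have hJ0 (y) : J y 0 = -conj (y 1) := rfl
  have hJ1 (y) : J y 1 = conj (y 0) := rfl
  have := not_hasForm_of_realCompletionIso e τ h.1 h.2.1 h.2.2 r J (δ := -1)
    (fun a y => funext fun i => ?_) (Or.inr rfl) (fun y => funext fun i => ?_) σ
  · rwa [neg_neg] at this
  · fin_cases i <;> apply Complex.ext <;>
      simp [hr, hJ0, hJ1, Fin.sum_univ_two, quaternionMatrix] <;> ring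
  · fin_cases i <;> simp [hJ0, hJ1]

theorem not_isPolarized_vr (e : E ≃ₐ[ℚ] Matrix (Fin n) (Fin n) D) (τ : PositiveInvolution E)
    (h : IsTypeI D ∨ IsTypeII D) : ¬ IsPolarized τ (Vr E) := by
  intro hp
  obtain ⟨σ⟩ : Nonempty (Center E →ₐ[ℚ] ℂ) := inferInstance
  have hreal : NumberField.IsTotallyReal (Subring.center D) := h.elim (fun h => h.2) fun h => h.2.1
  have h1 := hasForm_neg_one_of_isPolarized τ odd_one ((iso_multiple_one _).isPolarized hp)
    (bar_eq_of_totallyReal τ (conj_embedding_eq e hreal) σ)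
  exact h.elim (fun h => not_hasForm_of_isTypeI e τ h σ h1)
    (fun h => not_hasForm_of_isTypeII e τ h σ h1)

/-- Take `x - conj x` for an `x` that the complex conjugation of the CM field moves. -/
theorem exists_imaginary (e : E ≃ₐ[ℚ] Matrix (Fin n) (Fin n) D)
    (h : IsTypeIV D) :
    ∃ z : Center E, z ≠ 0 ∧ ∀ σ : Center E →ₐ[ℚ] ℂ, conj (σ z) = -σ z := by
  have h : NumberField.IsCMField (Subring.center D) := h
  let f : Center E →ₗ[ℚ] Subring.center D :=
    ((centerEquiv e).symm : Center E →+* Subring.center D).toRatAlgHom.toLinearMap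
  have : Module.Finite ℚ (Subring.center D) :=
    Module.Finite.of_surjective f (centerEquiv e).symm.surjective
  obtain ⟨x, hx⟩ : ∃ x, NumberField.IsCMField.complexConj (Subring.center D) x ≠ x := by
    by_contra! h1
    exact NumberField.IsCMField.complexConj_ne_one (Subring.center D) (AlgEquiv.ext h1)
  refine ⟨centerEquiv e (x - NumberField.IsCMField.complexConj (Subring.center D) x),
    fun h0 => hx ?_, fun σ => ?_⟩
  · rw [map_eq_zero_iff _ (centerEquiv e).injective] at h0
    exact (sub_eq_zero.1 h0).symm
  · have h1 := NumberField.IsCMField.complexEmbedding_complexConj (Subring.center D)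
      (centerEmbedding e σ) (x - NumberField.IsCMField.complexConj (Subring.center D) x)
    rw [map_sub (NumberField.IsCMField.complexConj (Subring.center D)),
      NumberField.IsCMField.complexConj_apply_apply, ← neg_sub, map_neg] at h1
    exact h1.symm

/-- In type III the symmetric sign is excluded, so every form is alternating. In type IV no
embedding is self-conjugate, so the condition is vacuous. -/
theorem isPolarized_vr_of_type (e : E ≃ₐ[ℚ] Matrix (Fin n) (Fin n) D) (τ : PositiveInvolution E)
    (h : IsTypeIII D ∨ IsTypeIV D) : IsPolarized τ (Vr E) := by
  refine isPolarized_vr τ fun σ hσ => ?_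
  rcases h with h | h
  · exact (hasForm_one_or_neg_one τ hσ).resolve_left (not_hasForm_of_isTypeIII e τ h σ)
  · obtain ⟨z, hz, hc⟩ := exists_imaginary e h
    exact absurd hσ (bar_ne_of_imaginary τ hz hc σ)

end Types

end RatRep

namespace RatRep

/-! ### The representation `V_rp` -/

section Generator

variable {E : Type u} [Ring E]

/-- A finite-dimensional representation is isomorphic to one in any given universe. -/
theorem exists_iso_ulift {V : Type*} [AddCommGroup V] [Module ℂ V] [FiniteDimensional ℂ V]
    (ρ : E →+* Module.End ℂ V) :
    ∃ (W : Type v) (_ : AddCommGroup W) (_ : Module ℂ W) (_ : FiniteDimensional ℂ W)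
      (θ : E →+* Module.End ℂ W), Iso ρ θ :=
  ⟨ULift.{v} (Fin (Module.finrank ℂ V) → ℂ), inferInstance, inferInstance, inferInstance, _,
    iso_transport ρ ((Module.finBasis ℂ V).equivFun.trans ULift.moduleEquiv.symm)⟩

variable [Algebra ℚ E] {τ : PositiveInvolution E}

/-- A generator of the rational polarized representations is unique up to isomorphism. -/
theorem GeneratesRationalPolarized.iso {V W : Type v}
    [AddCommGroup V] [Module ℂ V] [FiniteDimensional ℂ V]
    [AddCommGroup W] [Module ℂ W] [FiniteDimensional ℂ W]
    {θ : E →+* Module.End ℂ V} {ρ : E →+* Module.End ℂ W}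
    (hθ : GeneratesRationalPolarized τ θ) (hρ : GeneratesRationalPolarized τ ρ)
    (hpos : 0 < Module.finrank ℂ W) : Iso θ ρ := by
  obtain ⟨m, hm⟩ := hρ.2.2 V θ hθ.1 hθ.2.1
  obtain ⟨k, hk⟩ := hθ.2.2 W ρ hρ.1 hρ.2.1
  have h := hk.finrank_eq
  rw [finrank_multiple, hm.finrank_eq, finrank_multiple, ← mul_assoc] at h
  have h1 : k * m = 1 := (Nat.eq_of_mul_eq_mul_right hpos ((one_mul _).trans h)).symm
  obtain rfl := Nat.eq_one_of_mul_eq_one_left h1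
  exact hm.trans (iso_multiple_one ρ).symm

variable [IsSimpleRing E] [FiniteDimensional ℚ E]

/-- A copy of `V_r` or of `V_r ^ 2`, according to whether `V_r` is polarized or not, generates the
rational polarized representations. -/
theorem generatesRationalPolarized_of_iso {W : Type v} [AddCommGroup W] [Module ℂ W]
    [FiniteDimensional ℂ W] {ρ : E →+* Module.End ℂ W} {k : ℕ} (hk : k = 1 ∨ k = 2)
    (hp : k = 1 ↔ IsPolarized τ (Vr E)) (h : Iso (multiple k (Vr E)) ρ) :
    GeneratesRationalPolarized τ ρ := by
  refine ⟨h.isRational (isRational_multiple k (isRational_vr E)), h.isPolarized ?_, ?_⟩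
  · rcases hk with rfl | rfl
    · exact (iso_multiple_one _).isPolarized (hp.1 rfl)
    · exact isPolarized_multiple_two_vr τ
  · intro V _ _ _ θ hθ hθp
    obtain ⟨m, hm⟩ := exists_iso_multiple_vr θ fun z => hθ.exists_trace_eq z
    -- If `k = 2`, an odd polarized multiple would polarize `V_r` itself.
    obtain ⟨j, rfl⟩ : k ∣ m := by
      rcases hk with rfl | rfl
      · exact one_dvd m
      · refine even_iff_two_dvd.1 (Nat.not_odd_iff_even.1 fun hodd => ?_)
        exact absurd (hp.2 (isPolarized_vr_of_odd τ hodd (hm.isPolarized hθp))) (by decide)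
    rw [mul_comm] at hm
    exact ⟨j, (hm.trans (iso_multiple_multiple _ j k)).trans (h.multiple j)⟩

end Generator

end RatRep
end

/-! ### The main theorem -/

open RatRep in
theorem mainTheorem8
    {E : Type u} [Ring E] [Algebra ℚ E] [FiniteDimensional ℚ E] [IsSimpleRing E]
    (τ : PositiveInvolution E)
    {D : Type w} [DivisionRing D] [Algebra ℚ D] (n : ℕ)
    (e : E ≃ₐ[ℚ] Matrix (Fin n) (Fin n) D) :
    -- `V_r(E)` is rational and every rational representation is a multiple of it
    (IsRational (Vr E) ∧
      ∀ (V : Type v) [AddCommGroup V] [Module ℂ V] [FiniteDimensional ℂ V]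
        (ρ : E →+* Module.End ℂ V), IsRational ρ → ∃ m : ℕ, Iso ρ (multiple m (Vr E))) ∧
    -- `dim V_r(E) = deg E = n d f` with `d ^ 2 = [D : F]` and `f = [F : ℚ]`
    (∃ d : ℕ, d ^ 2 = Module.finrank (Subring.center D) D ∧
      Module.finrank ℂ (VrSpace E) = n * d * Module.finrank ℚ (Center E)) ∧
    -- existence and uniqueness of `V_rp(E)`, and its comparison with `V_r(E)`
    ∃ (W : Type v) (_ : AddCommGroup W) (_ : Module ℂ W) (_ : FiniteDimensional ℂ W)
      (Vrp : E →+* Module.End ℂ W),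
      GeneratesRationalPolarized τ Vrp ∧
      (∀ (W' : Type v) [AddCommGroup W'] [Module ℂ W'] [FiniteDimensional ℂ W']
        (θ : E →+* Module.End ℂ W'), GeneratesRationalPolarized τ θ → Iso θ Vrp) ∧
      (IsTypeIII D ∨ IsTypeIV D → Iso Vrp (Vr E)) ∧
      (IsTypeI D ∨ IsTypeII D → Iso Vrp (multiple 2 (Vr E))) := by
  refine ⟨⟨isRational_vr E, fun V _ _ _ ρ h =>
    exists_iso_multiple_vr ρ fun z => h.exists_trace_eq z⟩, exists_degree e, ?_⟩
  obtain ⟨k, hk, hp⟩ : ∃ k : ℕ, (k = 1 ∨ k = 2) ∧ (k = 1 ↔ IsPolarized τ (Vr E)) := by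
    by_cases h : IsPolarized τ (Vr E)
    · exact ⟨1, Or.inl rfl, by simpa using h⟩
    · exact ⟨2, Or.inr rfl, by simpa using h⟩
  -- The representation `V_r ^ k` lives in the universe of `E`, so it is copied to the universe in
  -- which `V_rp` is sought.
  obtain ⟨W, i₁, i₂, i₃, ρ, h⟩ := exists_iso_ulift.{u, v} (multiple k (Vr E))
  have hρ : GeneratesRationalPolarized τ ρ := generatesRationalPolarized_of_iso hk hp h
  have hpos : 0 < Module.finrank ℂ W := by
    rw [← h.finrank_eq, finrank_multiple]
    exact Nat.mul_pos (by omega) finrank_vrSpace_pos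
  refine ⟨W, i₁, i₂, i₃, ρ, hρ, fun V _ _ _ θ hθ => hθ.iso hρ hpos, fun hD => ?_, fun hD => ?_⟩
  · obtain rfl := hp.2 (isPolarized_vr_of_type e τ hD)
    exact h.symm.trans (iso_multiple_one _).symm
  · obtain rfl := hk.resolve_left fun h1 => not_isPolarized_vr e τ hD (hp.1 h1)
    exact h.symm
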